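/- All graphs are finite and undirected; parallel edges (and loops) are allowed. For a finite set $S$ of vertices, an \emph{$S$-forest} is a graph $B=(U,F)$ with $S\subseteq U$ whose edges can be oriented so that every $u\in U$ is the last vertex of exactly one directed walk starting in $S$ (equivalently, $B$ is a forest each of whose connected components contains exactly one vertex of $S$). For a graph $G=(V,E)$ and $k,h\in\mathbb Z_{>0}$, an \emph{$h$-regular packing of $k$ $S_i$-forests in $G$} is a family $B_1,\dots,B_k$ of pairwise edge-disjoint subgraphs of $G$, where $B_i$ is an $S_i$-forest, such that every vertex of $G$ belongs to exactly $h$ of $B_1,\dots,B_k$. For a partition $\mathcal P$ of $V$ (into nonempty sets), let $e_E(\mathcal P)$ be the number of edges in $E$ whose ends lie in two different members of $\mathcal P$. \textbf{Theorem.} Let $G=(V,E)$ be a graph, $h,k\in\mathbb Z_{>0}$, and let $\ell,\ell':\{0,1,\dots,k\}\to\mathbb Z_{>0}$ satisfy $$\sum_{i=1}^k\ell'(i)\ \ge\ \ell'(0)\ \ge\ \ell(0)\ \ge\ \sum_{i=1}^k\ell(i)\qquad\text{and}\qquad |V|\ge\ell'(i)\ge\ell(i)\quad\text{for every }1\le i\le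 k.$$ There exist vertex sets $S_1,\dots,S_k$ and an $h$-regular packing of $k$ $S_i$-forests $B_i$ in $G$ such that $$\ell(i)\le|S_i|\le\ell'(i)\quad\text{for every }1\le i\le k,\qquad \ell(0)\le\sum_{i=1}^k|S_i|\le\ell'(0),$$ if and only if $h|V|\ge\ell(0)$ and, for every partition $\mathcal P$ of $V$, $$\ell'(0)-\sum_{i=1}^k\ell(i)+\sum_{i=1}^k\min\{\ell(i),|\mathcal P|\}+e_E(\mathcal P)\ \ge\ h|\mathcal P|,$$ $$\sum_{i=1}^k\min\{\ell'(i),|\mathcal P|\}+e_E(\mathcal P)\ \ge\ h|\mathcal P|.$$ -/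

import Mathlib

open scoped Graph

namespace Graph

/-- `tail`, `head` give an orientation of the multigraph `H`: every edge `e` of `H` becomes an arc
from `tail e` to `head e` (values on non-edges are irrelevant). -/
def IsOrientation {α β : Type*} (H : Graph α β) (tail head : β → α) : Prop :=
  ∀ e ∈ E(H), H.IsLink e (tail e) (head e)

/-- `H.IsDiWalk tail head u w v`: the list of edges `w` is a directed walk from `u` to `v` in the
digraph obtained from `H` by orienting every edge `e` from `tail e` to `head e`. -/
inductive IsDiWalk {α β : Type*} (H : Graph α β) (tail head : β → α) : α → List β → α → Prop
  | nil {u : α} (hu : u ∈ V(H)) : IsDiWalk H tail head u [] u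
  | cons {e : β} {w : List β} {v : α} (he : e ∈ E(H))
      (hw : IsDiWalk H tail head (head e) w v) : IsDiWalk H tail head (tail e) (e :: w) v

/-- `H`, oriented by `tail` and `head`, is a branching with root set `S`: the roots are vertices of
`H`, and every vertex of `H` is reached from `S` in exactly one way. Uniqueness is required among
all directed walks (the unique walk is then automatically a path); this forces roots to have
in-degree `0` and all other vertices to have in-degree `1`, so no directed or undirected cycle
exists. -/
def IsBranching {α β : Type*} (H : Graph α β) (tail head : β → α) (S : Finset α) : Prop :=
  (S : Set α) ⊆ V(H) ∧
    ∀ u ∈ V(H), ∃! p : α × List β, p.1 ∈ S ∧ H.IsDiWalk tail head p.1 p.2 u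

/-- `H` is an `S`-forest: its edges can be oriented so that it becomes an `S`-branching. -/
def IsRootedForest {α β : Type*} (H : Graph α β) (S : Finset α) : Prop :=
  ∃ tail head : β → α, H.IsOrientation tail head ∧ H.IsBranching tail head S

/-- The family `B` is an `h`-regular packing in `G` of `k` rooted forests with root sets `S i`:
the `B i` are pairwise edge-disjoint `S i`-forests which are subgraphs of `G`, and every vertex of
`G` belongs to exactly `h` of them. -/
structure IsRegularForestPacking {α β : Type*} (G : Graph α β) (h : ℕ) {k : ℕ}
    (B : Fin k → Graph α β) (S : Fin k → Finset α) : Prop where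
  le : ∀ i, B i ≤ G
  isRootedForest : ∀ i, (B i).IsRootedForest (S i)
  edgeDisjoint : ∀ i j, i ≠ j → Disjoint E(B i) E(B j)
  regular : ∀ v ∈ V(G), {i : Fin k | v ∈ V(B i)}.ncard = h

/-- `e_E(P)`: the number of edges of `G` that enter some member of the partition `P` of `V(G)`,
that is, have exactly one end in some member of `P`. -/
noncomputable def numCrossing {α β : Type*} (G : Graph α β) (P : Partition V(G)) : ℕ :=
  {e : β | ∃ X ∈ P.parts, ∃ x y, G.IsLink e x y ∧ x ∈ X ∧ y ∉ X}.ncard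

end Graph

/-! Necessity is a count over the members of a partition P. Each member meets at least h of the
forests, and a forest B_i meeting a member X either has a root in X or contains an edge entering X;
distinct members use distinct roots and distinct entering arcs. Hence h|P| ≤ Σ min(|S_i|, |P|) +
e(P), and the bounds on |S_i| turn this into both partition inequalities.

For sufficiency, `exists_between_sum_eq` first fixes sizes s_i between ℓ(i) and ℓ'(i), with sum
min(ℓ'(0), h|V|), such that h|P| ≤ Σ min(s_i, |P|) + e(P) still holds for every P.

Roots are then treated as elements on a par with edges: the ground set is E together with all pairs
(vertex, colour). In the count matroid `CountIndep`, the elements supported in X and carrying c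
colours number at most h(|X| - 1) + min(h, c). What is wanted is an independent set of size h|V|
with s_i roots of colour i, that is, a common independent set with a partition matroid. Edmonds'
theorem `IsRankFun.exists_common_indep` provides it: tight sets of the count matroid form a
partition of V (`CountIndep.exists_partition`), so the rank condition comes down to the partition
inequality.

By Hall's theorem such a set can be oriented so that at least h|X| of its elements have their head
in each X (`CountIndep.exists_heads`). At most h(|X| - 1) + c of these lie inside X, where c counts
the root colours in X, so entering arcs plus c is at least h. Under this cut condition
`exists_isGrown_packing` grows the branchings arc by arc from the chosen roots, in the manner of
Lovász's proof of Edmonds' branching theorem. -/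

/-! ### Matroid rank functions and matroid intersection -/

/-- `r` is the rank function of a matroid on a finite ground set. -/
structure IsRankFun {Ω : Type*} [DecidableEq Ω] (r : Finset Ω → ℤ) : Prop where
  empty : r ∅ = 0
  mono : ∀ ⦃A B⦄, A ⊆ B → r A ≤ r B
  submod : ∀ A B, r (A ∪ B) + r (A ∩ B) ≤ r A + r B
  insert_le : ∀ x A, r (insert x A) ≤ r A + 1

namespace IsRankFun

variable {Ω : Type*} [DecidableEq Ω] {r r₁ r₂ : Finset Ω → ℤ}

lemma contract (hr : IsRankFun r) {x : Ω} (hx : r {x} = 1) :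
    IsRankFun fun A ↦ r (insert x A) - 1 where
  empty := by simp [hx]
  mono A B h := by have := hr.mono (Finset.insert_subset_insert x h); simpa using this
  submod A B := by
    have := hr.submod (insert x A) (insert x B)
    rw [← Finset.insert_union_distrib, ← Finset.insert_inter_distrib] at this
    linarith
  insert_le y A := by
    have := hr.insert_le y (insert x A)
    rw [Finset.insert_comm] at this
    linarith

lemma insert_of_loop (hr : IsRankFun r) {x : Ω} (hx : r {x} ≤ 0) (A : Finset Ω) :
    r (insert x A) = r A := by
  apply le_antisymm _ (hr.mono (Finset.subset_insert x A))
  have h := hr.submod {x} A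
  have h0 := hr.mono (Finset.empty_subset ({x} ∩ A))
  rw [hr.empty] at h0
  rw [Finset.insert_eq]
  linarith

/-- Edmonds' matroid intersection theorem, in terms of rank functions. -/
theorem exists_common_indep (hr₁ : IsRankFun r₁) (hr₂ : IsRankFun r₂) (W : Finset Ω) (m : ℕ)
    (hW : ∀ Z ⊆ W, (m : ℤ) ≤ r₁ Z + r₂ (W \ Z)) :
    ∃ I ⊆ W, I.card = m ∧ r₁ I = m ∧ r₂ I = m := by
  induction W using Finset.induction_on generalizing r₁ r₂ m with
  | empty =>
    have := hW ∅ (Finset.Subset.refl _)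
    simp only [Finset.sdiff_self, hr₁.empty, hr₂.empty] at this
    exact ⟨∅, Finset.Subset.refl _, by simp; omega, by rw [hr₁.empty]; omega,
      by rw [hr₂.empty]; omega⟩
  | insert e W he ih =>
    have hdel : (∀ Z ⊆ W, (m : ℤ) ≤ r₁ Z + r₂ (W \ Z)) →
        ∃ I ⊆ insert e W, I.card = m ∧ r₁ I = m ∧ r₂ I = m := fun h ↦ by
      obtain ⟨I, hI, h'⟩ := ih hr₁ hr₂ m h
      exact ⟨I, hI.trans (Finset.subset_insert _ _), h'⟩
    have hout : ∀ Z ⊆ W, insert e W \ insert e Z = W \ Z := fun Z hZ ↦ by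
      ext x; simp only [Finset.mem_sdiff, Finset.mem_insert]; grind
    have hin : ∀ Z ⊆ W, insert e W \ Z = insert e (W \ Z) := fun Z hZ ↦ by
      ext x; simp only [Finset.mem_sdiff, Finset.mem_insert]; grind
    by_cases h₁ : r₁ {e} ≤ 0
    · refine hdel fun Z hZ ↦ ?_
      have := hW (insert e Z) (Finset.insert_subset_insert e hZ)
      rwa [hout Z hZ, hr₁.insert_of_loop h₁] at this
    by_cases h₂ : r₂ {e} ≤ 0
    · refine hdel fun Z hZ ↦ ?_
      have := hW Z (hZ.trans (Finset.subset_insert _ _))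
      rwa [hin Z hZ, hr₂.insert_of_loop h₂] at this
    have h₁' : r₁ {e} = 1 := by
      have := hr₁.insert_le e ∅; rw [hr₁.empty, insert_empty_eq] at this; omega
    have h₂' : r₂ {e} = 1 := by
      have := hr₂.insert_le e ∅; rw [hr₂.empty, insert_empty_eq] at this; omega
    by_cases hd : ∀ Z ⊆ W, (m : ℤ) ≤ r₁ Z + r₂ (W \ Z)
    · exact hdel hd
    obtain _ | m := m
    · exact ⟨∅, Finset.empty_subset _, rfl, by simp [hr₁.empty], by simp [hr₂.empty]⟩
    -- Now `e` is to be used, so contract it. A set `Y` violating the condition after deletion is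
    -- uncrossed with any `Z`: submodularity of both ranks bounds two instances of `hW`, and the
    -- deficit at `Y` leaves the contracted condition for `Z`.
    obtain ⟨I, hI, hIc, hI₁, hI₂⟩ := ih (hr₁.contract h₁') (hr₂.contract h₂') m (by
      intro Z hZ
      push Not at hd
      obtain ⟨Y, hY, hYlt⟩ := hd
      have k₁ := hW (insert e (Y ∪ Z)) (Finset.insert_subset_insert e (Finset.union_subset hY hZ))
      have k₂ := hW (Y ∩ Z) ((Finset.inter_subset_left.trans hY).trans (Finset.subset_insert _ _))
      have s₁ := hr₁.submod Y (insert e Z)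
      have s₂ := hr₂.submod (W \ Y) (insert e (W \ Z))
      rw [hout _ (Finset.union_subset hY hZ)] at k₁
      rw [hin _ (Finset.inter_subset_left.trans hY)] at k₂
      have heY : e ∉ Y := fun h ↦ he (hY h)
      have e₁ : Y ∪ insert e Z = insert e (Y ∪ Z) := by
        ext x; simp only [Finset.mem_union, Finset.mem_insert]; tauto
      have e₂ : Y ∩ insert e Z = Y ∩ Z := Finset.inter_insert_of_notMem heY
      have e₃ : W \ Y ∪ insert e (W \ Z) = insert e (W \ (Y ∩ Z)) := by
        ext x
        simp only [Finset.mem_union, Finset.mem_insert, Finset.mem_sdiff, Finset.mem_inter]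
        tauto
      have e₄ : W \ Y ∩ insert e (W \ Z) = W \ (Y ∪ Z) := by
        rw [Finset.inter_insert_of_notMem (by simp [he]), Finset.sdiff_union_distrib]
      rw [e₁, e₂] at s₁
      rw [e₃, e₄] at s₂
      push_cast at *
      linarith)
    refine ⟨insert e I, Finset.insert_subset_insert e hI, ?_, ?_, ?_⟩
    · rw [Finset.card_insert_of_notMem fun h ↦ he (hI h), hIc]
    · push_cast; linarith
    · push_cast; linarith

end IsRankFun

/-! ### Ranks of independence systems and of partition matroids -/

open Classical in
/-- The largest size of a subset of `Z` satisfying `Indep`. -/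
noncomputable def indepRank {Ω : Type*} (Indep : Finset Ω → Prop) (Z : Finset Ω) : ℕ :=
  (Z.powerset.filter Indep).sup Finset.card

section indepRank

variable {Ω : Type*} {Indep : Finset Ω → Prop}

lemma le_indepRank {I Z : Finset Ω} (hI : Indep I) (hIZ : I ⊆ Z) :
    I.card ≤ indepRank Indep Z := by
  classical
  exact Finset.le_sup (f := Finset.card) (by simp [hI, hIZ])

lemma exists_indepRank (h0 : Indep ∅) (Z : Finset Ω) :
    ∃ I ⊆ Z, Indep I ∧ I.card = indepRank Indep Z := by
  classical
  obtain ⟨I, hI, h⟩ := Finset.exists_mem_eq_sup (Z.powerset.filter Indep)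
    ⟨∅, by simp [h0]⟩ Finset.card
  rw [Finset.mem_filter, Finset.mem_powerset] at hI
  exact ⟨I, hI.1, hI.2, h.symm⟩

variable [DecidableEq Ω]

lemma exists_superset_indepRank (h0 : Indep ∅)
    (haug : ∀ I J, Indep I → Indep J → I.card < J.card → ∃ x ∈ J, x ∉ I ∧ Indep (insert x I))
    {I Z : Finset Ω} (hI : Indep I) (hIZ : I ⊆ Z) :
    ∃ J, I ⊆ J ∧ J ⊆ Z ∧ Indep J ∧ J.card = indepRank Indep Z := by
  obtain ⟨K, hKZ, hK, hKc⟩ := exists_indepRank h0 Z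
  obtain ⟨n, hn⟩ : ∃ n, n = K.card - I.card := ⟨_, rfl⟩
  induction n generalizing I with
  | zero =>
    have := le_indepRank hI hIZ
    exact ⟨I, subset_rfl, hIZ, hI, by omega⟩
  | succ n ih =>
    obtain ⟨x, hxK, hxI, hx⟩ := haug I K hI hK (by omega)
    obtain ⟨J, hJ, hJ'⟩ := ih hx (Finset.insert_subset (hKZ hxK) hIZ)
      (by rw [Finset.card_insert_of_notMem hxI]; omega)
    exact ⟨J, (Finset.subset_insert x I).trans hJ, hJ'⟩

lemma isRankFun_indepRank (h0 : Indep ∅) (hsub : ∀ I J, Indep J → I ⊆ J → Indep I)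
    (haug : ∀ I J, Indep I → Indep J → I.card < J.card → ∃ x ∈ J, x ∉ I ∧ Indep (insert x I)) :
    IsRankFun fun Z ↦ (indepRank Indep Z : ℤ) where
  empty := by
    obtain ⟨I, hI, -, hc⟩ := exists_indepRank h0 (∅ : Finset Ω)
    rw [← hc, Finset.subset_empty.1 hI]; simp
  mono A B h := by
    obtain ⟨I, hI, hi, hc⟩ := exists_indepRank h0 A
    simp only [← hc, Nat.cast_le]
    exact le_indepRank hi (hI.trans h)
  submod A B := by
    obtain ⟨I, hI, hi, hc⟩ := exists_indepRank h0 (A ∩ B)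
    -- A basis of `A ∩ B` is extended to a basis of `A ∪ B`, whose traces on `A` and `B` bound the
    -- two ranks from below.
    obtain ⟨J, hIJ, hJ, hj, hJc⟩ := exists_superset_indepRank h0 haug hi
      (hI.trans (Finset.inter_subset_left.trans (Finset.subset_union_left (s₂ := B))))
    have hA := le_indepRank (hsub (J ∩ A) J hj Finset.inter_subset_left)
      (Finset.inter_subset_right (s₂ := A))
    have hB := le_indepRank (hsub (J ∩ B) J hj Finset.inter_subset_left)
      (Finset.inter_subset_right (s₂ := B))
    have h := Finset.card_union_add_card_inter (J ∩ A) (J ∩ B)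
    rw [← Finset.inter_union_distrib_left, Finset.inter_eq_left.2 hJ] at h
    have h' : I.card ≤ (J ∩ A ∩ (J ∩ B)).card := Finset.card_le_card fun x hx ↦ by
      have := hI hx
      have := hIJ hx
      simp_all
    omega
  insert_le x A := by
    obtain ⟨I, hI, hi, hc⟩ := exists_indepRank h0 (insert x A)
    have h := le_indepRank (hsub (I.erase x) I hi (Finset.erase_subset _ _))
      (Finset.subset_insert_iff.1 hI)
    have := Finset.pred_card_le_card_erase (s := I) (a := x)
    omega

end indepRank

/-- The rank function of a partition matroid. -/
lemma isRankFun_partition {Ω ι : Type*} [DecidableEq Ω] [Fintype ι] [DecidableEq ι] (c : Ω → ι)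
    (cap : ι → ℕ) :
    IsRankFun fun Z : Finset Ω ↦ ∑ i, (min (cap i : ℤ) (Z.filter (c · = i)).card : ℤ) where
  empty := by simp
  mono A B h := Finset.sum_le_sum fun i _ ↦ by
    have := Finset.card_le_card (Finset.filter_subset_filter (c · = i) h)
    omega
  submod A B := by
    rw [← Finset.sum_add_distrib, ← Finset.sum_add_distrib]
    refine Finset.sum_le_sum fun i _ ↦ ?_
    have h := Finset.card_union_add_card_inter (A.filter (c · = i)) (B.filter (c · = i))
    rw [← Finset.filter_union, ← Finset.filter_inter_distrib] at h
    have h₁ := Finset.card_le_card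
      (Finset.filter_subset_filter (c · = i) (Finset.subset_union_left (s₁ := A) (s₂ := B)))
    have h₂ := Finset.card_le_card
      (Finset.filter_subset_filter (c · = i) (Finset.subset_union_right (s₁ := A) (s₂ := B)))
    omega
  insert_le x A := by
    rw [← Finset.sum_erase_add _ _ (Finset.mem_univ (c x)),
      ← Finset.sum_erase_add Finset.univ _ (Finset.mem_univ (c x))]
    have h : ∀ i ∈ Finset.univ.erase (c x), (min (cap i : ℤ) ((insert x A).filter (c · = i)).card : ℤ) =
        min (cap i : ℤ) (A.filter (c · = i)).card := fun i hi ↦ by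
      rw [Finset.filter_insert, if_neg (Finset.ne_of_mem_erase hi).symm]
    rw [Finset.sum_congr rfl h, Finset.filter_insert, if_pos rfl]
    have := Finset.card_insert_le x (A.filter (c · = c x))
    omega

/-! ### The count matroid on coloured elements -/

/-- Independence in the count matroid of `X ↦ h (|X| - 1) + min h c`: a set `T` of elements supported
in a nonempty vertex set `X` and carrying `c` colours has at most `h (|X| - 1) + min h c` elements. -/
def CountIndep {V Ω κ : Type*} [DecidableEq κ] (supp : Ω → Finset V) (col : Ω → Finset κ) (h : ℕ)
    (I : Finset Ω) : Prop :=
  ∀ X : Finset V, X.Nonempty → ∀ T ⊆ I, (∀ x ∈ T, supp x ⊆ X) →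
    T.card + h ≤ h * X.card + min h (T.biUnion col).card

namespace CountIndep

variable {V Ω κ : Type*} [DecidableEq κ]
  {supp : Ω → Finset V} {col : Ω → Finset κ} {h : ℕ} {I J : Finset Ω}

lemma empty : CountIndep supp col h ∅ := fun X hX T hT _ ↦ by
  rw [Finset.subset_empty.1 hT]
  have := Nat.le_mul_of_pos_right h hX.card_pos
  simpa using this

lemma subset (hJ : CountIndep supp col h J) (hIJ : I ⊆ J) : CountIndep supp col h I :=
  fun X hX T hT ↦ hJ X hX T (hT.trans hIJ)

lemma min_card_union_add_min_card_inter_le (A B : Finset κ) :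
    min h (A ∪ B).card + min h (A ∩ B).card ≤ min h A.card + min h B.card := by
  have := Finset.card_union_add_card_inter A B
  have := Finset.card_le_card (Finset.subset_union_left (s₁ := A) (s₂ := B))
  have := Finset.card_le_card (Finset.subset_union_right (s₁ := A) (s₂ := B))
  omega

lemma card_eq_sum_of_cover [Fintype V] [DecidableEq V] {P : Finset (Finset V × Finset Ω)}
    (hd : (P : Set (Finset V × Finset Ω)).PairwiseDisjoint Prod.fst)
    (hc : ∀ v, ∃ p ∈ P, v ∈ p.1) : Fintype.card V = ∑ p ∈ P, p.1.card := by
  rw [← Finset.card_biUnion hd, ← Finset.card_univ]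
  congr 1
  exact (Finset.eq_univ_of_forall fun v ↦ Finset.mem_biUnion.2 (hc v)).symm

variable [DecidableEq V] [DecidableEq Ω]

/-- Tight pairs with intersecting vertex sets are closed under union. -/
lemma tight_union (hI : CountIndep supp col h I) {X X' : Finset V} {T T' : Finset Ω}
    (hT : ∀ x ∈ T, supp x ⊆ X) (hT' : ∀ x ∈ T', supp x ⊆ X') (hX : (X ∩ X').Nonempty)
    (ht : h * X.card + min h (T.biUnion col).card ≤ (T ∩ I).card + h)
    (ht' : h * X'.card + min h (T'.biUnion col).card ≤ (T' ∩ I).card + h) :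
    h * (X ∪ X').card + min h ((T ∪ T').biUnion col).card ≤ ((T ∪ T') ∩ I).card + h := by
  have h₁ := hI (X ∩ X') hX (T ∩ T' ∩ I) Finset.inter_subset_right (fun x hx ↦ by
    simp only [Finset.mem_inter] at hx
    exact Finset.subset_inter (hT x hx.1.1) (hT' x hx.1.2))
  have h₂ := Finset.card_le_card (s := (T ∩ T' ∩ I).biUnion col)
    (t := T.biUnion col ∩ T'.biUnion col) (Finset.biUnion_subset.2 fun x hx ↦ by
      simp only [Finset.mem_inter] at hx
      exact Finset.subset_inter (Finset.subset_biUnion_of_mem col hx.1.1)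
        (Finset.subset_biUnion_of_mem col hx.1.2))
  have h₃ := min_card_union_add_min_card_inter_le (h := h) (T.biUnion col) (T'.biUnion col)
  rw [← Finset.union_biUnion] at h₃
  have h₄ := congrArg (h * ·) (Finset.card_union_add_card_inter X X')
  simp only [mul_add] at h₄
  have h₅ := Finset.card_union_add_card_inter (T ∩ I) (T' ∩ I)
  rw [← Finset.union_inter_distrib_right, ← Finset.inter_inter_distrib_right] at h₅
  omega

variable [Fintype V]

/-- The maximal tight pairs certify the size of a maximal independent subset `I` of `Z`. -/
theorem exists_partition (hI : CountIndep supp col h I) (hs : ∀ x, (supp x).Nonempty)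
    {Z : Finset Ω} (hIZ : I ⊆ Z)
    (hmax : ∀ x ∈ Z, x ∉ I → ¬ CountIndep supp col h (insert x I)) :
    ∃ P : Finset (Finset V × Finset Ω),
      (∀ p ∈ P, p.1.Nonempty ∧ ∀ x ∈ p.2, supp x ⊆ p.1) ∧
      (P : Set (Finset V × Finset Ω)).PairwiseDisjoint Prod.fst ∧
      (∀ v, ∃ p ∈ P, v ∈ p.1) ∧
      h * Fintype.card V + ∑ p ∈ P, min h (p.2.biUnion col).card + (Z \ P.biUnion Prod.snd).card ≤
        I.card + h * P.card := by
  classical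
  -- Tight pairs: `I` attains the bound on `T`, with colours counted over all of `T` and not only
  -- over `T ∩ I`. The trivial pair `({v}, ∅)` is tight, so every vertex lies in a maximal one.
  let Q : Finset (Finset V × Finset Ω) := (Finset.univ ×ˢ Z.powerset).filter fun p ↦
    (∀ x ∈ p.2, supp x ⊆ p.1) ∧
      h * p.1.card + min h (p.2.biUnion col).card ≤ (p.2 ∩ I).card + h
  have hQ : ∀ p, p ∈ Q ↔ p.2 ⊆ Z ∧ (∀ x ∈ p.2, supp x ⊆ p.1) ∧
      h * p.1.card + min h (p.2.biUnion col).card ≤ (p.2 ∩ I).card + h := fun p ↦ by simp [Q]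
  have hunion : ∀ p ∈ Q, ∀ q ∈ Q, (p.1 ∩ q.1).Nonempty → (p.1 ∪ q.1, p.2 ∪ q.2) ∈ Q := by
    intro p hp q hq hpq
    rw [hQ] at *
    refine ⟨Finset.union_subset hp.1 hq.1, fun x hx ↦ ?_,
      hI.tight_union hp.2.1 hq.2.1 hpq hp.2.2 hq.2.2⟩
    obtain hx | hx := Finset.mem_union.1 hx
    · exact (hp.2.1 x hx).trans Finset.subset_union_left
    · exact (hq.2.1 x hx).trans Finset.subset_union_right
  have hex : ∀ v, ∃ p ∈ Q, v ∈ p.1 ∧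
      ∀ q ∈ Q, v ∈ q.1 → q.1.card + q.2.card ≤ p.1.card + p.2.card := by
    intro v
    obtain ⟨p, hp, hpm⟩ := Finset.exists_max_image (Q.filter (v ∈ ·.1))
      (fun p ↦ p.1.card + p.2.card) ⟨({v}, ∅), by simp [hQ]⟩
    rw [Finset.mem_filter] at hp
    exact ⟨p, hp.1, hp.2, fun q hq hv ↦ hpm q (Finset.mem_filter.2 ⟨hq, hv⟩)⟩
  choose F hFQ hvF hFm using hex
  have hle : ∀ v, ∀ q ∈ Q, ((F v).1 ∩ q.1).Nonempty → q.1 ⊆ (F v).1 ∧ q.2 ⊆ (F v).2 := by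
    intro v q hq hne
    have h := hFm v _ (hunion _ (hFQ v) _ hq hne) (Finset.mem_union_left _ (hvF v))
    have h₁ := Finset.card_le_card (Finset.subset_union_left (s₁ := (F v).1) (s₂ := q.1))
    have h₂ := Finset.card_le_card (Finset.subset_union_left (s₁ := (F v).2) (s₂ := q.2))
    simp only at h
    have e₁ := Finset.eq_of_subset_of_card_le
      (Finset.subset_union_left (s₁ := (F v).1) (s₂ := q.1)) (by omega)
    have e₂ := Finset.eq_of_subset_of_card_le
      (Finset.subset_union_left (s₁ := (F v).2) (s₂ := q.2)) (by omega)
    exact ⟨e₁ ▸ Finset.subset_union_right, e₂ ▸ Finset.subset_union_right⟩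
  have hdisj : ((Finset.univ.image F : Finset _) : Set (Finset V × Finset Ω)).PairwiseDisjoint
      Prod.fst := by
    intro p hp q hq hpq
    simp only [Finset.coe_image, Finset.coe_univ, Set.image_univ, Set.mem_range] at hp hq
    obtain ⟨v, rfl⟩ := hp
    obtain ⟨w, rfl⟩ := hq
    by_contra hne
    rw [Function.onFun, Finset.not_disjoint_iff_nonempty_inter] at hne
    have h₁ := hle v _ (hFQ w) hne
    have h₂ := hle w _ (hFQ v) (by rwa [Finset.inter_comm])
    exact hpq (Prod.ext (h₂.1.antisymm h₁.1) (h₂.2.antisymm h₁.2))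
  have hdisj' : ((Finset.univ.image F : Finset _) : Set (Finset V × Finset Ω)).PairwiseDisjoint
      Prod.snd := by
    intro p hp q hq hpq
    have hd := hdisj hp hq hpq
    simp only [Finset.coe_image, Finset.coe_univ, Set.image_univ, Set.mem_range] at hp hq
    obtain ⟨v, rfl⟩ := hp
    obtain ⟨w, rfl⟩ := hq
    refine Finset.disjoint_left.2 fun x hxv hxw ↦ ?_
    obtain ⟨u, hu⟩ := hs x
    exact Finset.disjoint_left.1 hd (((hQ _).1 (hFQ v)).2.1 x hxv hu)
      (((hQ _).1 (hFQ w)).2.1 x hxw hu)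
  refine ⟨Finset.univ.image F, ?_, hdisj, fun v ↦ ⟨F v, by simp, hvF v⟩, ?_⟩
  · simp only [Finset.mem_image, Finset.mem_univ, true_and, forall_exists_index,
      forall_apply_eq_imp_iff]
    exact fun v ↦ ⟨⟨v, hvF v⟩, ((hQ _).1 (hFQ v)).2.1⟩
  have hV := card_eq_sum_of_cover hdisj fun v ↦ ⟨F v, by simp, hvF v⟩
  -- An element of `Z` outside `I` creates a violated pair when added. That pair, still containing
  -- the element, is tight for `I`, so it is absorbed by a maximal tight pair.
  have hout : Z \ (Finset.univ.image F).biUnion Prod.snd ⊆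
      I \ (Finset.univ.image F).biUnion Prod.snd := by
    intro x hx
    rw [Finset.mem_sdiff] at hx ⊢
    refine ⟨?_, hx.2⟩
    by_contra hxI
    have hdep := hmax x hx.1 hxI
    simp only [CountIndep, not_forall, not_le] at hdep
    obtain ⟨X, hX, T, hTI, hTX, hlt⟩ := hdep
    have hxT : x ∈ T := by
      by_contra hxT
      have := hI X hX T ((Finset.subset_insert_iff_of_notMem hxT).1 hTI) hTX
      omega
    have hcard : (T ∩ I).card + 1 = T.card := by
      have : T ∩ I = T.erase x := by
        ext y
        have := @hTI y
        simp only [Finset.mem_insert, Finset.mem_inter, Finset.mem_erase] at this ⊢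
        constructor
        · rintro ⟨h₁, h₂⟩
          exact ⟨fun h ↦ hxI (h ▸ h₂), h₁⟩
        · rintro ⟨h₁, h₂⟩
          exact ⟨h₂, (this h₂).resolve_left h₁⟩
      rw [this, Finset.card_erase_add_one hxT]
    have hq : (X, T) ∈ Q := (hQ _).2 ⟨hTI.trans (Finset.insert_subset hx.1 hIZ), hTX, by
      simp only; omega⟩
    obtain ⟨v, hv⟩ := hX
    have := (hle v _ hq ⟨v, Finset.mem_inter.2 ⟨hvF v, hv⟩⟩).2 hxT
    exact hx.2 (Finset.mem_biUnion.2 ⟨F v, by simp, this⟩)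
  have hsum : ∑ p ∈ Finset.univ.image F, (h * p.1.card + min h (p.2.biUnion col).card) ≤
      ∑ p ∈ Finset.univ.image F, ((p.2 ∩ I).card + h) := Finset.sum_le_sum fun p hp ↦ by
    obtain ⟨v, -, rfl⟩ := Finset.mem_image.1 hp
    exact ((hQ _).1 (hFQ v)).2.2
  rw [Finset.sum_add_distrib, Finset.sum_add_distrib, ← Finset.mul_sum, ← hV, Finset.sum_const,
    smul_eq_mul] at hsum
  have hIin : ∑ p ∈ Finset.univ.image F, (p.2 ∩ I).card =
      (((Finset.univ.image F).biUnion Prod.snd) ∩ I).card := by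
    rw [Finset.biUnion_inter, Finset.card_biUnion]
    exact fun p hp q hq hpq ↦ (hdisj' hp hq hpq).mono Finset.inter_subset_left
      Finset.inter_subset_left
  have hIcard := Finset.card_sdiff_add_card_inter I ((Finset.univ.image F).biUnion Prod.snd)
  rw [Finset.inter_comm] at hIcard
  have := Finset.card_le_card hout
  rw [mul_comm h (Finset.image F _).card]
  omega

/-- If no element of `J` extends `I`, then `I` is maximal in `I ∪ J`, and the partition certifying
its size bounds every independent subset of `I ∪ J`, in particular `J`. -/
lemma augment (hs : ∀ x, (supp x).Nonempty) (hI : CountIndep supp col h I)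
    (hJ : CountIndep supp col h J) (hIJ : I.card < J.card) :
    ∃ x ∈ J, x ∉ I ∧ CountIndep supp col h (insert x I) := by
  by_contra! hno
  obtain ⟨P, hP, hd, hc, hle⟩ := hI.exists_partition hs (Finset.subset_union_left (s₂ := J))
    fun x hx hxI ↦ hno x ((Finset.mem_union.1 hx).resolve_left hxI) hxI
  have hsum : ∑ p ∈ P, ((p.2 ∩ J).card + h) ≤
      ∑ p ∈ P, (h * p.1.card + min h (p.2.biUnion col).card) := Finset.sum_le_sum fun p hp ↦ by
    refine (hJ p.1 (hP p hp).1 (p.2 ∩ J) Finset.inter_subset_right fun x hx ↦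
      (hP p hp).2 x (Finset.mem_inter.1 hx).1).trans ?_
    have := Finset.card_le_card
      (Finset.biUnion_subset_biUnion_of_subset_left col (Finset.inter_subset_left (s₁ := p.2) (s₂ := J)))
    omega
  rw [Finset.sum_add_distrib, Finset.sum_add_distrib, ← Finset.mul_sum, ← card_eq_sum_of_cover hd hc,
    Finset.sum_const, smul_eq_mul, mul_comm P.card] at hsum
  have h₁ := Finset.card_sdiff_add_card_inter J (P.biUnion Prod.snd)
  rw [Finset.inter_comm, Finset.biUnion_inter] at h₁
  have h₂ : (P.biUnion fun p ↦ p.2 ∩ J).card ≤ _ := Finset.card_biUnion_le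
  have h₃ := Finset.card_le_card (Finset.sdiff_subset_sdiff
    (Finset.subset_union_right (s₁ := I) (s₂ := J)) (Finset.Subset.refl (P.biUnion Prod.snd)))
  omega

lemma isRankFun (hs : ∀ x, (supp x).Nonempty) :
    IsRankFun fun Z ↦ (indepRank (CountIndep supp col h) Z : ℤ) :=
  isRankFun_indepRank empty (fun _ _ hJ hIJ ↦ hJ.subset hIJ) fun _ _ hI hJ hIJ ↦
    hI.augment hs hJ hIJ

end CountIndep

/-! ### Growing branchings under a cut condition -/

section packing

variable {V E κ : Type*} [DecidableEq V]

/-- The arcs of `A` entering `X`. -/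
def entering (tail head : E → V) (A : Finset E) (X : Finset V) : Finset E :=
  A.filter fun e ↦ head e ∈ X ∧ tail e ∉ X


lemma card_entering_inter_add_union_le (tail head : E → V) (A : Finset E) (X Y : Finset V) :
    (entering tail head A (X ∩ Y)).card + (entering tail head A (X ∪ Y)).card ≤
      (entering tail head A X).card + (entering tail head A Y).card := by
  simp only [entering, Finset.card_filter, ← Finset.sum_add_distrib]
  refine Finset.sum_le_sum fun e _ ↦ ?_
  simp only [Finset.mem_inter, Finset.mem_union]
  by_cases h₁ : head e ∈ X <;> by_cases h₂ : head e ∈ Y <;> by_cases h₃ : tail e ∈ X <;>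
    by_cases h₄ : tail e ∈ Y <;> simp [h₁, h₂, h₃, h₄]

variable [DecidableEq E] [DecidableEq κ] {tail head : E → V} {A : Finset E} {C : V → Finset κ} {h : ℕ}

/-- `C v` is the set of branchings that already contain `v`. The arc is sought inside a minimal
tight set that still has an unsaturated vertex missing some colour of the set; minimality makes its
use safe for every cut. -/
lemma exists_growing_arc [Fintype V]
    (hcut : ∀ X : Finset V, X.Nonempty → h ≤ (entering tail head A X).card + (X.biUnion C).card)
    {v₀ : V} (hv₀ : (C v₀).card < h) :
    ∃ e ∈ A, ∃ i ∈ C (tail e), i ∉ C (head e) ∧ (C (head e)).card < h ∧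
      ∀ X : Finset V, X.Nonempty → h ≤ (entering tail head (A.erase e) X).card +
        (X.biUnion (Function.update C (head e) (insert i (C (head e))))).card := by
  classical
  let Q : Finset (Finset V) := Finset.univ.filter fun X ↦
    ((entering tail head A X).card + (X.biUnion C).card = h ∨ X = Finset.univ) ∧
      ∃ v ∈ X, (C v).card < h ∧ (C v).card < (X.biUnion C).card
  obtain ⟨X, hXQ, hXmin⟩ := Finset.exists_min_image Q Finset.card ⟨Finset.univ, by
    have h₁ := hcut Finset.univ ⟨v₀, Finset.mem_univ _⟩
    simp only [entering, Finset.mem_univ, not_true_eq_false, and_false, Finset.filter_false,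
      Finset.card_empty, zero_add] at h₁
    simp only [Q, Finset.mem_filter, Finset.mem_univ, true_and, or_true]
    exact ⟨v₀, hv₀, by omega⟩⟩
  simp only [Q, Finset.mem_filter, Finset.mem_univ, true_and] at hXQ hXmin
  obtain ⟨hX, v, hvX, hvh, hvlt⟩ := hXQ
  have harc : ∃ e ∈ A, tail e ∈ X ∧ head e ∈ X ∧ (C (head e)).card < h ∧
      ∃ i ∈ C (tail e), i ∉ C (head e) := by
    by_contra! hno
    -- Without such an arc, every arc entering `Y` also enters `X`, while `Y` has fewer colours than
    -- `X`, or fewer than `h` when `X` is everything; this breaks the cut condition at `Y`.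
    let Y := X.filter fun y ↦ C y ⊆ C v
    have hY : entering tail head A Y ⊆ entering tail head A X := by
      intro e he
      simp only [entering, Y, Finset.mem_filter, not_and] at he ⊢
      refine ⟨he.1, he.2.1.1, fun htX ↦ he.2.2 htX ?_⟩
      have hlt := (Finset.card_le_card he.2.1.2).trans_lt hvh
      exact fun i hi ↦ he.2.1.2 (hno e he.1 htX he.2.1.1 hlt i hi)
    have hcY : Y.biUnion C ⊆ C v := Finset.biUnion_subset.2 fun y hy ↦ (Finset.mem_filter.1 hy).2
    have h₁ := hcut Y ⟨v, Finset.mem_filter.2 ⟨hvX, subset_rfl⟩⟩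
    have h₂ := Finset.card_le_card hY
    have h₃ := Finset.card_le_card hcY
    obtain hX | rfl := hX
    · omega
    · have : entering tail head A Finset.univ = ∅ := by simp [entering]
      rw [this, Finset.card_empty] at h₂
      omega
  obtain ⟨e, heA, htX, hhX, hlt, i, hit, hih⟩ := harc
  refine ⟨e, heA, i, hit, hih, hlt, fun Z hZ ↦ ?_⟩
  have hmono : Z.biUnion C ⊆
      Z.biUnion (Function.update C (head e) (insert i (C (head e)))) := by
    refine Finset.biUnion_mono fun z _ ↦ ?_
    by_cases hz : z = head e
    · subst hz; simp
    · simp [hz]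
  have hmonoc := Finset.card_le_card hmono
  have hin : entering tail head (A.erase e) Z = (entering tail head A Z).erase e :=
    Finset.filter_erase ..
  by_cases hent : head e ∈ Z ∧ tail e ∉ Z
  swap
  · rw [hin, Finset.erase_eq_of_notMem (by simp [entering, hent])]
    have := hcut Z hZ
    omega
  have hmem : e ∈ entering tail head A Z := by simp [entering, hent, heA]
  rw [hin, Finset.card_erase_of_mem hmem]
  have hpos := Finset.card_pos.2 ⟨e, hmem⟩
  have hcZ := hcut Z hZ
  by_cases hiZ : i ∈ Z.biUnion C
  swap
  · have : Z.biUnion C ⊂ Z.biUnion (Function.update C (head e) (insert i (C (head e)))) :=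
      hmono.ssubset_of_mem_notMem
        (Finset.mem_biUnion.2 ⟨head e, hent.1, by simp⟩) hiZ
    have := Finset.card_lt_card this
    omega
  by_cases htight : (entering tail head A Z).card + (Z.biUnion C).card = h
  swap
  · omega
  exfalso
  -- The only cuts at risk are tight sets `Z` entered by `e` that already have colour `i`. A tight
  -- part of `X ∩ Z` with `head e` and colour `i` would be a candidate smaller than `X`, since `tail
  -- e` is not in `Z`. Uncrossing `X` with `Z` produces one.
  have key : ∀ Y ⊆ X ∩ Z, head e ∈ Y → i ∈ Y.biUnion C →
      (entering tail head A Y).card + (Y.biUnion C).card = h → False := by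
    intro Y hY hhY hiY hYt
    have hss : C (head e) ⊂ Y.biUnion C :=
      (Finset.subset_biUnion_of_mem C hhY).ssubset_of_mem_notMem hiY hih
    have h₁ := hXmin Y ⟨Or.inl hYt, head e, hhY, hlt, Finset.card_lt_card hss⟩
    have h₂ : Y ⊂ X := (hY.trans Finset.inter_subset_left).ssubset_of_mem_notMem htX
      fun ht ↦ hent.2 (Finset.mem_inter.1 (hY ht)).2
    have := Finset.card_lt_card h₂
    omega
  obtain hX | rfl := hX
  swap
  · exact key Z (by simp) hent.1 hiZ htight
  have hne : head e ∈ X ∩ Z := Finset.mem_inter.2 ⟨hhX, hent.1⟩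
  have s₁ := card_entering_inter_add_union_le tail head A X Z
  have s₂ := Finset.card_union_add_card_inter (X.biUnion C) (Z.biUnion C)
  have c₁ := hcut (X ∩ Z) ⟨_, hne⟩
  have c₂ := hcut (X ∪ Z) ⟨_, Finset.mem_union_left _ hhX⟩
  rw [Finset.union_biUnion] at c₂
  have hsub : (X ∩ Z).biUnion C ⊆ X.biUnion C ∩ Z.biUnion C := Finset.subset_inter
    (Finset.biUnion_subset_biUnion_of_subset_left _ Finset.inter_subset_left)
    (Finset.biUnion_subset_biUnion_of_subset_left _ Finset.inter_subset_right)
  have hle := Finset.card_le_card hsub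
  refine key (X ∩ Z) subset_rfl hne ?_ (by omega)
  rw [Finset.eq_of_subset_of_card_le hsub (by omega)]
  exact Finset.mem_inter.2 ⟨Finset.mem_biUnion.2 ⟨_, htX, hit⟩, hiZ⟩

/-- `IsGrown tail head S W F`: starting from the vertex set `S`, one obtains `W` by successively
adding the arcs of `F`, each leading from a vertex already reached to a new one. -/
inductive IsGrown (tail head : E → V) (S : Finset V) : Finset V → Finset E → Prop
  | base : IsGrown tail head S S ∅
  | step {W : Finset V} {F : Finset E} (e : E) (hW : IsGrown tail head S W F)
      (ht : tail e ∈ W) (hh : head e ∉ W) (he : e ∉ F) :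
      IsGrown tail head S (insert (head e) W) (insert e F)

/-- Packing of branchings in a digraph in which every vertex set satisfies the cut condition. -/
theorem exists_isGrown_packing [Fintype V] [Fintype κ] (S W : κ → Finset V) (F : κ → Finset E)
    (hW : ∀ i, IsGrown tail head (S i) (W i) (F i)) (hF : ∀ i, Disjoint (F i) A)
    (hFF : ∀ i j, i ≠ j → Disjoint (F i) (F j))
    (hle : ∀ v, (Finset.univ.filter (v ∈ W ·)).card ≤ h)
    (hcut : ∀ X : Finset V, X.Nonempty →
      h ≤ (entering tail head A X).card + (X.biUnion fun v ↦ Finset.univ.filter (v ∈ W ·)).card) :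
    ∃ (W' : κ → Finset V) (F' : κ → Finset E), (∀ i, IsGrown tail head (S i) (W' i) (F' i)) ∧
      (∀ i, F' i ⊆ F i ∪ A) ∧ (∀ i j, i ≠ j → Disjoint (F' i) (F' j)) ∧
      ∀ v, (Finset.univ.filter (v ∈ W' ·)).card = h := by
  obtain ⟨n, hn⟩ : ∃ n, n = A.card := ⟨_, rfl⟩
  induction n generalizing A W F with
  | zero =>
    refine ⟨W, F, hW, fun i ↦ Finset.subset_union_left, hFF, fun v ↦ le_antisymm (hle v) ?_⟩
    -- With no arcs left, the cut condition at a single vertex says that it is in at least `h`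
    -- branchings.
    have := hcut {v} (Finset.singleton_nonempty v)
    rw [Finset.card_eq_zero.1 hn.symm] at this
    simpa [entering] using this
  | succ n ih =>
    by_cases hfull : ∀ v, h ≤ (Finset.univ.filter (v ∈ W ·)).card
    · exact ⟨W, F, hW, fun i ↦ Finset.subset_union_left, hFF, fun v ↦ le_antisymm (hle v) (hfull v)⟩
    push Not at hfull
    obtain ⟨v₀, hv₀⟩ := hfull
    obtain ⟨e, heA, i, hit, hih, hlt, hcut'⟩ := exists_growing_arc hcut hv₀
    simp only [Finset.mem_filter, Finset.mem_univ, true_and] at hit hih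
    have heF : ∀ j, e ∉ F j := fun j hj ↦ Finset.disjoint_left.1 (hF j) hj heA
    have hupd : (fun v ↦ Finset.univ.filter (v ∈ Function.update W i (insert (head e) (W i)) ·)) =
        Function.update (fun v ↦ Finset.univ.filter (v ∈ W ·)) (head e)
          (insert i (Finset.univ.filter (head e ∈ W ·))) := by
      funext v
      by_cases hv : v = head e
      · subst hv
        ext j
        by_cases hj : j = i
        · subst hj; simp
        · simp [hj]
      · ext j
        by_cases hj : j = i
        · subst hj; simp [hv]
        · simp [hj, hv]
    obtain ⟨W', F', h₁, h₂, h₃, h₄⟩ := ih (A := A.erase e)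
      (Function.update W i (insert (head e) (W i))) (Function.update F i (insert e (F i)))
      (fun j ↦ by
        by_cases hj : j = i
        · subst hj; simpa using IsGrown.step e (hW j) hit hih (heF j)
        · simpa [hj] using hW j)
      (fun j ↦ by
        have := (hF j).mono_right (Finset.erase_subset e A)
        by_cases hj : j = i
        · subst hj; simpa [Finset.disjoint_insert_left] using this
        · simpa [hj] using this)
      (fun j j' hjj' ↦ by
        by_cases hj : j = i
        · subst hj; simpa [hjj'.symm, Finset.disjoint_insert_left, heF] using hFF j j' hjj'
        · by_cases hj' : j' = i
          · subst hj'; simpa [hjj', Finset.disjoint_insert_right, heF] using hFF j j' hjj'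
          · simpa [hj, hj'] using hFF j j' hjj')
      (fun v ↦ by
        rw [congrFun hupd v]
        by_cases hv : v = head e
        · subst hv
          rw [Function.update_self]
          exact (Finset.card_insert_le _ _).trans hlt
        · rw [Function.update_of_ne hv]; exact hle v)
      (by rw [hupd]; exact hcut')
      (by rw [Finset.card_erase_of_mem heA]; omega)
    refine ⟨W', F', h₁, fun j ↦ (h₂ j).trans ?_, h₃, h₄⟩
    by_cases hj : j = i
    · subst hj
      intro x
      simp only [Function.update_self, Finset.mem_union, Finset.mem_insert, Finset.mem_erase]
      rintro ((rfl | hx) | hx)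
      · exact Or.inr heA
      · exact Or.inl hx
      · exact Or.inr hx.2
    · rw [Function.update_of_ne hj]
      exact Finset.union_subset_union subset_rfl (Finset.erase_subset _ _)

end packing

/-! ### Orientation by Hall's theorem and counting inequalities -/

lemma IsRankFun.le_add_card_sdiff {Ω : Type*} [DecidableEq Ω] {r : Finset Ω → ℤ}
    (hr : IsRankFun r) (A B : Finset Ω) : r A ≤ r B + (A \ B).card := by
  have key : ∀ D : Finset Ω, r (D ∪ B) ≤ r B + D.card := by
    intro D
    induction D using Finset.induction_on with
    | empty => simp
    | insert x D hx ih =>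
      have := hr.insert_le x (D ∪ B)
      rw [Finset.insert_union, Finset.card_insert_of_notMem hx]
      push_cast
      linarith
  have := key (A \ B)
  rw [Finset.sdiff_union_self_eq_union] at this
  exact (hr.mono Finset.subset_union_left).trans this

/-- The heads of an orientation of an independent set of full size. -/
lemma CountIndep.exists_heads {V Ω κ : Type*} [Fintype V] [DecidableEq V] [DecidableEq Ω]
    [DecidableEq κ] {supp : Ω → Finset V} {col : Ω → Finset κ} {h : ℕ} {I : Finset Ω}
    (hI : CountIndep supp col h I) (hs : ∀ x, (supp x).Nonempty)
    (hcard : I.card = h * Fintype.card V) :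
    ∃ hd : Ω → V, (∀ x, hd x ∈ supp x) ∧
      ∀ X : Finset V, h * X.card ≤ (I.filter (hd · ∈ X)).card := by
  -- Each vertex is offered in `h` copies. Independence gives Hall's condition, as min(h, c) ≤ h,
  -- and `hcard` makes the resulting injection a bijection.
  have hall : ∀ A : Finset I, A.card ≤
      (A.biUnion fun x ↦ supp x ×ˢ (Finset.univ : Finset (Fin h))).card := by
    intro A
    obtain rfl | ⟨x₀, hx₀⟩ := A.eq_empty_or_nonempty
    · simp
    have hsub : A.biUnion (fun x ↦ supp x) ×ˢ (Finset.univ : Finset (Fin h)) ⊆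
        A.biUnion fun x ↦ supp x ×ˢ (Finset.univ : Finset (Fin h)) := by
      intro p hp
      simpa using hp
    refine le_trans ?_ (Finset.card_le_card hsub)
    obtain ⟨v, hv⟩ := hs x₀
    have := hI (A.biUnion fun x ↦ supp x) ⟨v, Finset.mem_biUnion.2 ⟨x₀, hx₀, hv⟩⟩
      (A.map (Function.Embedding.subtype _)) (fun x hx ↦ by
        obtain ⟨y, -, rfl⟩ := Finset.mem_map.1 hx
        exact y.2) (fun x hx ↦ by
        obtain ⟨y, hy, rfl⟩ := Finset.mem_map.1 hx
        exact Finset.subset_biUnion_of_mem (fun x : I ↦ supp x) hy)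
    rw [Finset.card_map] at this
    rw [Finset.card_product, Finset.card_univ, Fintype.card_fin, mul_comm]
    omega
  obtain ⟨f, hf, hfs⟩ := (Finset.all_card_le_biUnion_card_iff_exists_injective _).1 hall
  have hsurj : Function.Surjective f := ((Fintype.bijective_iff_injective_and_card f).2 ⟨hf, by
    simp [hcard, mul_comm]⟩).2
  refine ⟨fun x ↦ if hx : x ∈ I then (f ⟨x, hx⟩).1 else (hs x).choose, fun x ↦ ?_, fun X ↦ ?_⟩
  · by_cases hx : x ∈ I
    · simpa [hx] using hfs ⟨x, hx⟩
    · simpa [hx] using (hs x).choose_spec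
  · have h₁ : X ×ˢ (Finset.univ : Finset (Fin h)) ⊆ (I.attach.filter fun x ↦ (f x).1 ∈ X).image f := by
      intro p hp
      obtain ⟨x, rfl⟩ := hsurj p
      exact Finset.mem_image_of_mem f (by simpa using hp)
    have h₂ := (Finset.card_le_card h₁).trans Finset.card_image_le
    rw [Finset.card_product, Finset.card_univ, Fintype.card_fin, mul_comm] at h₂
    refine h₂.trans ?_
    rw [← Finset.card_map (Function.Embedding.subtype _)]
    refine Finset.card_le_card fun x hx ↦ ?_
    obtain ⟨y, hy, rfl⟩ := Finset.mem_map.1 hx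
    simpa using hy

/-- `q ↦ ∑ i, min (s i) q` is concave and vanishes at `0`. -/
lemma mul_le_sum_min_add {ι : Type*} [Fintype ι] (s : ι → ℕ) {h q e : ℕ}
    (hq : h * (q + 1) ≤ ∑ i, min (s i) (q + 1) + e) : h * q ≤ ∑ i, min (s i) q + e := by
  have h₁ : ∑ i, min (s i) (q + 1) = ∑ i, min (s i) q + (Finset.univ.filter (q < s ·)).card := by
    rw [Finset.card_filter, ← Finset.sum_add_distrib]
    refine Finset.sum_congr rfl fun i _ ↦ ?_
    split_ifs <;> omega
  have h₂ : (Finset.univ.filter (q < s ·)).card * q ≤ ∑ i, min (s i) q := by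
    rw [← smul_eq_mul, ← Finset.sum_const, Finset.sum_filter]
    refine Finset.sum_le_sum fun i _ ↦ ?_
    split_ifs <;> omega
  -- At most `h` terms exceed `q`: the last increment is at most `h` and can be subtracted. More
  -- than `h` do: they alone contribute at least `h * q`.
  obtain hle | hlt := le_or_gt (Finset.univ.filter (q < s ·)).card h
  · rw [mul_add, h₁] at hq
    omega
  · have := Nat.mul_le_mul_right q hlt.le
    omega

/-- A subset of a grid has large rank in one of two partition matroids. -/
lemma sum_le_sum_min_add_sum_min {V κ : Type*} [Fintype V] [DecidableEq V] [Fintype κ]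
    [DecidableEq κ] [Nonempty V] {h : ℕ} {s : κ → ℕ} (hs : ∀ i, s i ≤ Fintype.card V)
    (hsum : ∑ i, s i ≤ h * Fintype.card V) (Y : Finset (V × κ)) :
    ∑ i, s i ≤ ∑ v, min h (Finset.univ.filter fun i ↦ (v, i) ∈ Y).card +
      ∑ i, min (s i) (Finset.univ.filter fun v ↦ (v, i) ∉ Y).card := by
  have hn : 0 < Fintype.card V := Fintype.card_pos
  refine Nat.le_of_mul_le_mul_left ?_ hn
  -- Averaging: every cell `(v, i)` gets weight `s i / |V|`. Row sums are then at most `h`, column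
  -- sums at most `s i`, and each weight at most `1`; denominators are cleared by multiplying by
  -- `|V|`.
  have h₁ : ∀ v, ∑ i ∈ Finset.univ.filter (fun i ↦ (v, i) ∈ Y), s i ≤
      Fintype.card V * min h (Finset.univ.filter fun i ↦ (v, i) ∈ Y).card := by
    intro v
    rw [← Nat.mul_min_mul_left]
    refine le_min ?_ ?_
    · rw [mul_comm]
      exact (Finset.sum_le_sum_of_subset (Finset.subset_univ _)).trans hsum
    · rw [mul_comm, ← smul_eq_mul]
      exact Finset.sum_le_card_nsmul _ _ _ fun i _ ↦ hs i
  have h₂ : ∀ i, ∑ v ∈ Finset.univ.filter (fun v ↦ (v, i) ∉ Y), s i ≤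
      Fintype.card V * min (s i) (Finset.univ.filter fun v ↦ (v, i) ∉ Y).card := by
    intro i
    rw [Finset.sum_const, smul_eq_mul, ← Nat.mul_min_mul_left]
    refine le_min (Nat.mul_le_mul_right _ (Finset.card_le_univ _)) ?_
    rw [mul_comm]
    exact Nat.mul_le_mul_right _ (hs i)
  have h₃ : ∑ v, ∑ i ∈ Finset.univ.filter (fun i ↦ (v, i) ∈ Y), s i =
      ∑ i, ∑ v ∈ Finset.univ.filter (fun v ↦ (v, i) ∈ Y), s i := by
    simp only [Finset.sum_filter]
    exact Finset.sum_comm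
  have h₄ : ∀ i, ∑ v ∈ Finset.univ.filter (fun v ↦ (v, i) ∈ Y), s i +
      ∑ v ∈ Finset.univ.filter (fun v ↦ (v, i) ∉ Y), s i = Fintype.card V * s i := fun i ↦ by
    rw [Finset.sum_filter_add_sum_filter_not]
    simp
  rw [mul_add, Finset.mul_sum, Finset.mul_sum, Finset.mul_sum]
  calc ∑ i, Fintype.card V * s i
      = ∑ v, ∑ i ∈ Finset.univ.filter (fun i ↦ (v, i) ∈ Y), s i +
          ∑ i, ∑ v ∈ Finset.univ.filter (fun v ↦ (v, i) ∉ Y), s i := by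
        rw [h₃, ← Finset.sum_add_distrib]
        exact Finset.sum_congr rfl fun i _ ↦ (h₄ i).symm
    _ ≤ _ := add_le_add (Finset.sum_le_sum fun v _ ↦ h₁ v) (Finset.sum_le_sum fun i _ ↦ h₂ i)

/-! ### Edges and coloured roots as one ground set -/

section rooted

variable {V E κ : Type*}

/-- The vertices touched by an edge, or by a coloured root. -/
def rootedSupp [DecidableEq V] (a b : E → V) : E ⊕ V × κ → Finset V :=
  Sum.elim (fun e ↦ {a e, b e}) fun p ↦ {p.1}

/-- The colours carried by an edge (none), or by a coloured root. -/
def rootedCol : E ⊕ V × κ → Finset κ := Sum.elim (fun _ ↦ ∅) fun p ↦ {p.2}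

/-- The class of an edge (`none`), or of a coloured root. -/
def rootedClass : E ⊕ V × κ → Option κ := Sum.elim (fun _ ↦ none) fun p ↦ some p.2

@[simp] lemma rootedClass_inl (e : E) : rootedClass (Sum.inl e : E ⊕ V × κ) = none := rfl

@[simp] lemma rootedClass_inr (p : V × κ) : rootedClass (Sum.inr p : E ⊕ V × κ) = some p.2 := rfl

lemma rootedSupp_nonempty [DecidableEq V] (a b : E → V) (x : E ⊕ V × κ) :
    (rootedSupp a b x).Nonempty := by
  rcases x with e | p <;> simp [rootedSupp]

variable [DecidableEq κ]

lemma mem_biUnion_rootedCol {T : Finset (E ⊕ V × κ)} {i : κ} :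
    i ∈ T.biUnion rootedCol ↔ ∃ v, Sum.inr (v, i) ∈ T := by
  simp only [Finset.mem_biUnion, rootedCol]
  constructor
  · rintro ⟨e | ⟨v, j⟩, hx, hi⟩
    · simp at hi
    · obtain rfl : i = j := by simpa using hi
      exact ⟨v, hx⟩
  · rintro ⟨v, hv⟩
    exact ⟨_, hv, by simp⟩

variable [DecidableEq V] [DecidableEq E]

lemma card_rootedClass_none [Fintype E] (U : Finset (E ⊕ V × κ)) :
    (U.filter (rootedClass · = none)).card =
      (Finset.univ.filter fun e ↦ Sum.inl e ∈ U).card := by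
  have := Finset.card_map (Function.Embedding.inl (β := V × κ))
    (s := Finset.univ.filter fun e : E ↦ Sum.inl e ∈ U)
  rw [← this]
  congr 1
  ext x
  rcases x with e | p <;> simp

lemma card_rootedClass_some [Fintype V] (U : Finset (E ⊕ V × κ)) (i : κ) :
    (U.filter (rootedClass · = some i)).card =
      (Finset.univ.filter fun v ↦ Sum.inr (v, i) ∈ U).card := by
  have := Finset.card_map ((Function.Embedding.sectL V i).trans (Function.Embedding.inr (α := E)))
    (s := Finset.univ.filter fun v ↦ Sum.inr (v, i) ∈ U)
  rw [← this]
  congr 1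
  ext x
  rcases x with e | ⟨v, j⟩
  · simp
  · simp only [rootedClass_inr, Finset.mem_filter, Finset.mem_univ, true_and,
      Finset.mem_map, Option.some.injEq, Function.Embedding.trans_apply,
      Function.Embedding.sectL_apply, Function.Embedding.inr_apply, Sum.inr.injEq, Prod.mk.injEq]
    constructor
    · rintro ⟨h₁, rfl⟩; exact ⟨v, h₁, rfl, rfl⟩
    · rintro ⟨w, h₁, rfl, rfl⟩; exact ⟨h₁, rfl⟩

variable [Fintype V] [Fintype E] [Fintype κ]

/-- The condition on partitions of the vertex set bounds the dual side of the intersection of the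
count matroid with the partition matroid on the classes. -/
lemma mul_card_le_of_partition_condition {a b : E → V} {h : ℕ} {s : κ → ℕ}
    (hP : ∀ φ : V → Finset V, h * (Finset.univ.image φ).card ≤
      ∑ i, min (s i) (Finset.univ.image φ).card + (Finset.univ.filter fun e ↦ φ (a e) ≠ φ (b e)).card)
    {P : Finset (Finset V × Finset (E ⊕ V × κ))}
    (hsupp : ∀ p ∈ P, p.1.Nonempty ∧ ∀ x ∈ p.2, rootedSupp a b x ⊆ p.1)
    (hdisj : (P : Set (Finset V × Finset (E ⊕ V × κ))).PairwiseDisjoint Prod.fst)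
    (hcov : ∀ v, ∃ p ∈ P, v ∈ p.1) :
    h * P.card ≤ ∑ p ∈ P, min h (p.2.biUnion rootedCol).card +
      (Finset.univ.filter fun e ↦ Sum.inl e ∉ P.biUnion Prod.snd).card +
      ∑ i, min (s i) (Finset.univ.filter fun v ↦ Sum.inr (v, i) ∉ P.biUnion Prod.snd).card := by
  have huniq : ∀ p ∈ P, ∀ q ∈ P, ∀ v, v ∈ p.1 → v ∈ q.1 → p = q := by
    intro p hp q hq v hvp hvq
    by_contra hpq
    exact Finset.disjoint_left.1 (hdisj hp hq hpq) hvp hvq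
  choose F hFP hvF using hcov
  have hF : ∀ p ∈ P, ∀ v ∈ p.1, F v = p := fun p hp v hv ↦ huniq _ (hFP v) _ hp v (hvF v) hv
  -- Classes with at least `h` colours already pay for themselves. `φ` merges all of them into one
  -- extra class, labelled `∅`.
  set Q := P.filter fun p ↦ (p.2.biUnion rootedCol).card < h with hQdef
  let φ : V → Finset V := fun v ↦ if F v ∈ Q then (F v).1 else ∅
  have hcross : (Finset.univ.filter fun e ↦ φ (a e) ≠ φ (b e)).card ≤
      (Finset.univ.filter fun e ↦ Sum.inl e ∉ P.biUnion Prod.snd).card := by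
    refine Finset.card_le_card fun e he ↦ ?_
    simp only [Finset.mem_filter, Finset.mem_univ, true_and, Finset.mem_biUnion, not_exists,
      not_and] at he ⊢
    intro p hp hep
    have hs := (hsupp p hp).2 _ hep
    simp only [rootedSupp, Sum.elim_inl, Finset.insert_subset_iff,
      Finset.singleton_subset_iff] at hs
    exact he (by simp only [φ, hF p hp _ hs.1, hF p hp _ hs.2])
  have hinj : Set.InjOn Prod.fst (Q : Set (Finset V × Finset (E ⊕ V × κ))) := by
    intro p hp q hq hpq
    have hp' := (Finset.mem_filter.1 hp).1
    obtain ⟨v, hv⟩ := (hsupp p hp').1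
    exact huniq p hp' q (Finset.mem_filter.1 hq).1 v hv (hpq ▸ hv)
  have hsub : Q.image Prod.fst ⊆ Finset.univ.image φ := by
    intro X hX
    obtain ⟨p, hp, rfl⟩ := Finset.mem_image.1 hX
    have hp' := (Finset.mem_filter.1 hp).1
    obtain ⟨v, hv⟩ := (hsupp p hp').1
    refine Finset.mem_image.2 ⟨v, Finset.mem_univ _, ?_⟩
    simp only [φ, hF p hp' v hv, if_pos hp]
  have hsup : Finset.univ.image φ ⊆ insert ∅ (Q.image Prod.fst) := by
    intro X hX
    obtain ⟨v, -, rfl⟩ := Finset.mem_image.1 hX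
    by_cases hv : F v ∈ Q
    · simp only [φ, if_pos hv]
      exact Finset.mem_insert_of_mem (Finset.mem_image_of_mem _ hv)
    · simp [φ, hv]
  have hcond : h * Q.card ≤ ∑ i, min (s i) Q.card +
      (Finset.univ.filter fun e ↦ Sum.inl e ∉ P.biUnion Prod.snd).card := by
    have hQc := Finset.card_image_of_injOn hinj
    have h₁ := Finset.card_le_card hsub
    have h₂ := (Finset.card_le_card hsup).trans (Finset.card_insert_le _ _)
    have h₃ := hP φ
    -- The merged class may add one to the size of the partition; concavity of the truncated sum
    -- removes it.
    obtain heq | heq : (Finset.univ.image φ).card = Q.card ∨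
        (Finset.univ.image φ).card = Q.card + 1 := by omega
    · rw [heq] at h₃
      omega
    · rw [heq] at h₃
      exact mul_le_sum_min_add s (h₃.trans (by omega))
  have hcol : ∑ p ∈ Q, (p.2.biUnion rootedCol).card =
      ∑ i, (Q.filter fun p ↦ i ∈ p.2.biUnion rootedCol).card := by
    have : ∀ p : Finset V × Finset (E ⊕ V × κ), (p.2.biUnion rootedCol).card =
        ∑ i, if i ∈ p.2.biUnion rootedCol then 1 else 0 := fun p ↦ by
      rw [← Finset.card_filter]; congr 1; ext; simp
    simp only [this, Finset.card_filter]
    exact Finset.sum_comm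
  -- Any vertex of a class lacking colour `i` yields an uncovered root of colour `i`; disjoint
  -- classes yield distinct vertices.
  have hfree : ∀ i, (Q.filter fun p ↦ i ∉ p.2.biUnion rootedCol).card ≤
      (Finset.univ.filter fun v ↦ Sum.inr (v, i) ∉ P.biUnion Prod.snd).card := by
    intro i
    obtain hE | ⟨p₀, hp₀⟩ := (Q.filter fun p ↦ i ∉ p.2.biUnion rootedCol).eq_empty_or_nonempty
    · rw [hE]; exact Nat.zero_le _
    have : Nonempty V := ⟨(hsupp p₀ (by simp_all [Q])).1.choose⟩
    choose! g hg using fun p hp ↦ (hsupp p hp).1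
    refine Finset.card_le_card_of_injOn g (fun p hp ↦ ?_) fun p hp q hq hpq ↦ ?_
    · simp only [Finset.coe_filter, Set.mem_ofPred_eq, Q, Finset.mem_filter] at hp
      simp only [Finset.coe_filter, Set.mem_ofPred_eq, Finset.mem_univ, true_and,
        Finset.mem_biUnion, not_exists, not_and]
      intro q hq hmem
      have hgq : g p ∈ q.1 := (hsupp q hq).2 _ hmem (by simp [rootedSupp])
      obtain rfl := huniq p hp.1.1 q hq _ (hg p hp.1.1) hgq
      exact hp.2 (mem_biUnion_rootedCol.2 ⟨_, hmem⟩)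
    · simp only [Finset.coe_filter, Set.mem_ofPred_eq, Q, Finset.mem_filter] at hp hq
      exact huniq p hp.1.1 q hq.1.1 _ (hg p hp.1.1) (hpq ▸ hg q hq.1.1)
  have hmin : ∑ i, min (s i) Q.card ≤ ∑ p ∈ Q, (p.2.biUnion rootedCol).card +
      ∑ i, min (s i) (Finset.univ.filter fun v ↦ Sum.inr (v, i) ∉ P.biUnion Prod.snd).card := by
    rw [hcol, ← Finset.sum_add_distrib]
    refine Finset.sum_le_sum fun i _ ↦ ?_
    have h₁ := hfree i
    have h₂ := Finset.card_filter_add_card_filter_not (s := Q) fun p ↦ i ∈ p.2.biUnion rootedCol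
    omega
  have hsplit : ∑ p ∈ P, min h (p.2.biUnion rootedCol).card =
      ∑ p ∈ Q, (p.2.biUnion rootedCol).card +
        h * (P.filter fun p ↦ ¬ (p.2.biUnion rootedCol).card < h).card := by
    rw [← Finset.sum_filter_add_sum_filter_not P fun p ↦ (p.2.biUnion rootedCol).card < h]
    congr 1
    · refine Finset.sum_congr rfl fun p hp ↦ ?_
      have := (Finset.mem_filter.1 hp).2
      omega
    · rw [mul_comm, ← smul_eq_mul, ← Finset.sum_const]
      refine Finset.sum_congr rfl fun p hp ↦ ?_
      have := (Finset.mem_filter.1 hp).2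
      omega
  have hPc := congrArg (h * ·) (Finset.card_filter_add_card_filter_not (s := P)
    fun p ↦ (p.2.biUnion rootedCol).card < h)
  simp only [mul_add, ← hQdef] at hPc
  omega

end rooted

section rooted

variable {V E κ : Type*} [DecidableEq V] [DecidableEq E] [DecidableEq κ]
  [Fintype V] [Fintype κ]

lemma card_eq_sum_of_no_edges {T : Finset (E ⊕ V × κ)} (hT : ∀ e, Sum.inl e ∉ T) :
    T.card = ∑ v, (Finset.univ.filter fun i ↦ Sum.inr (v, i) ∈ T).card := by
  have h₁ : T = (Finset.univ.filter fun p ↦ Sum.inr p ∈ T).map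
      (Function.Embedding.inr (α := E) (β := V × κ)) := by
    ext x
    rcases x with e | p <;> simp [hT]
  conv_lhs => rw [h₁]
  rw [Finset.card_map, Finset.card_filter, Fintype.sum_prod_type]
  simp only [Finset.card_filter]

/-- Roots at one fixed vertex of `X` have distinct colours, which pays for the colour term; every
other vertex of `X` carries at most `h` roots. -/
lemma countIndep_of_no_edges {a b : E → V} {h : ℕ} {J : Finset (E ⊕ V × κ)}
    (hJ : ∀ e, Sum.inl e ∉ J)
    (hle : ∀ v, (Finset.univ.filter fun i ↦ Sum.inr (v, i) ∈ J).card ≤ h) :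
    CountIndep (rootedSupp a b) rootedCol h J := by
  rintro X ⟨v, hv⟩ T hTJ hTX
  rw [card_eq_sum_of_no_edges fun e he ↦ hJ e (hTJ he)]
  have hsub : ∀ w, (Finset.univ.filter fun i ↦ Sum.inr (w, i) ∈ T).card ≤
      (Finset.univ.filter fun i ↦ Sum.inr (w, i) ∈ J).card := fun w ↦
    Finset.card_le_card (Finset.monotone_filter_right _ fun i _ hi ↦ hTJ hi)
  have h₁ : ∑ w, (Finset.univ.filter fun i ↦ Sum.inr (w, i) ∈ T).card =
      ∑ w ∈ X, (Finset.univ.filter fun i ↦ Sum.inr (w, i) ∈ T).card := by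
    refine (Finset.sum_subset (Finset.subset_univ X) fun w _ hw ↦ ?_).symm
    rw [Finset.card_eq_zero, Finset.filter_eq_empty_iff]
    exact fun i _ hi ↦ hw (hTX _ hi (by simp [rootedSupp]))
  have h₂ : ∑ w ∈ X.erase v, (Finset.univ.filter fun i ↦ Sum.inr (w, i) ∈ T).card ≤
      (X.erase v).card * h := by
    rw [← smul_eq_mul]
    exact Finset.sum_le_card_nsmul _ _ _ fun w _ ↦ (hsub w).trans (hle w)
  have h₃ : (Finset.univ.filter fun i ↦ Sum.inr (v, i) ∈ T).card ≤ (T.biUnion rootedCol).card :=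
    Finset.card_le_card fun i hi ↦ mem_biUnion_rootedCol.2 ⟨v, by simpa using hi⟩
  have h₄ := (hsub v).trans (hle v)
  rw [h₁, ← Finset.sum_erase_add _ _ hv]
  have h₅ : h * X.card = (X.erase v).card * h + h := by
    rw [← Finset.card_erase_add_one hv]; ring
  omega

lemma sum_min_le_indepRank {a b : E → V} {h : ℕ} (Z : Finset (E ⊕ V × κ)) :
    ∑ v, min h (Finset.univ.filter fun i ↦ Sum.inr (v, i) ∈ Z).card ≤
      indepRank (CountIndep (rootedSupp a b) rootedCol h) Z := by
  have : ∀ v, ∃ D ⊆ Finset.univ.filter fun i ↦ Sum.inr (v, i) ∈ Z,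
      D.card = min h (Finset.univ.filter fun i ↦ Sum.inr (v, i) ∈ Z).card :=
    fun v ↦ Finset.exists_subset_card_eq (min_le_right _ _)
  choose D hD hDc using this
  let J : Finset (E ⊕ V × κ) := (Finset.univ.filter fun p : V × κ ↦ p.2 ∈ D p.1).map
    Function.Embedding.inr
  have hJe : ∀ e, Sum.inl e ∉ J := by simp [J]
  have hJv : ∀ v, (Finset.univ.filter fun i ↦ Sum.inr (v, i) ∈ J) = D v := by
    intro v; ext i; simp [J]
  have hJ : CountIndep (rootedSupp a b) rootedCol h J := countIndep_of_no_edges hJe fun v ↦ by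
    rw [hJv, hDc]; exact min_le_left _ _
  refine le_trans ?_ (le_indepRank hJ fun x hx ↦ ?_)
  · rw [card_eq_sum_of_no_edges hJe]
    exact Finset.sum_le_sum fun v _ ↦ by rw [hJv, hDc]
  · obtain ⟨p, hp, rfl⟩ := Finset.mem_map.1 hx
    simpa using hD p.1 (Finset.mem_filter.1 hp).2

variable [Fintype E]

lemma sum_min_rootedClass_compl (cap : Option κ → ℕ) (U : Finset (E ⊕ V × κ)) :
    ∑ c, (min (cap c : ℤ) ((Finset.univ \ U).filter (rootedClass · = c)).card : ℤ) =
      min (cap none : ℤ) (Finset.univ.filter fun e ↦ Sum.inl e ∉ U).card +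
        ∑ i, (min (cap (some i) : ℤ) (Finset.univ.filter fun v ↦ Sum.inr (v, i) ∉ U).card : ℤ) := by
  rw [Fintype.sum_option, card_rootedClass_none]
  simp only [card_rootedClass_some, Finset.mem_sdiff, Finset.mem_univ, true_and]

/-- Choice of edges and coloured roots forming a full-size independent set of the count matroid,
with prescribed numbers of roots of each colour. -/
theorem exists_countIndep_card_eq [Nonempty V] {a b : E → V} {h : ℕ} {s : κ → ℕ}
    (hs : ∀ i, s i ≤ Fintype.card V) (hsum : ∑ i, s i ≤ h * Fintype.card V)
    (hP : ∀ φ : V → Finset V, h * (Finset.univ.image φ).card ≤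
      ∑ i, min (s i) (Finset.univ.image φ).card +
        (Finset.univ.filter fun e ↦ φ (a e) ≠ φ (b e)).card) :
    ∃ I : Finset (E ⊕ V × κ), CountIndep (rootedSupp a b) rootedCol h I ∧
      I.card = h * Fintype.card V ∧
      ∀ i, (Finset.univ.filter fun v ↦ Sum.inr (v, i) ∈ I).card = s i := by
  -- The edge capacity is chosen so that all capacities sum to `h * |V|`; a common independent set
  -- of that size must fill every class.
  let cap : Option κ → ℕ := fun c ↦ c.elim (h * Fintype.card V - ∑ i, s i) s
  have hr := CountIndep.isRankFun (col := rootedCol (κ := κ)) (h := h)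
    (rootedSupp_nonempty (κ := κ) a b)
  obtain ⟨I, -, hIc, hI₁, hI₂⟩ := hr.exists_common_indep
    (isRankFun_partition (rootedClass (V := V) (E := E)) cap) Finset.univ (h * Fintype.card V) (by
      intro Z _
      rw [sum_min_rootedClass_compl]
      simp only [cap, Option.elim_none, Option.elim_some]
      -- If the edge capacity does not bind outside `Z`, it can be replaced by `|E|` and the
      -- partition condition applies. If it binds, the edges contribute exactly `h * |V| - ∑ s i`,
      -- and the grid inequality for roots alone covers the rest.
      by_cases hZ : (Finset.univ.filter fun e ↦ Sum.inl e ∉ Z).card ≤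
          h * Fintype.card V - ∑ i, s i
      · obtain ⟨I, hIZ, hI, hIc⟩ := exists_indepRank
          (Indep := CountIndep (rootedSupp a b) rootedCol h) CountIndep.empty Z
        obtain ⟨P, hsupp, hdisj, hcov, hcert⟩ := hI.exists_partition (rootedSupp_nonempty a b) hIZ
          fun x hxZ hxI hx ↦ by
            have := le_indepRank hx (Finset.insert_subset hxZ hIZ)
            rw [Finset.card_insert_of_notMem hxI] at this
            omega
        have hpart := mul_card_le_of_partition_condition hP hsupp hdisj hcov
        have hle := (isRankFun_partition (rootedClass (V := V) (E := E) (κ := κ))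
          fun c ↦ c.elim (Fintype.card E) s).le_add_card_sdiff
            (Finset.univ \ P.biUnion Prod.snd) (Finset.univ \ Z)
        have hdiff : (Finset.univ \ P.biUnion Prod.snd) \ (Finset.univ \ Z) =
            Z \ P.biUnion Prod.snd := by
          ext x; simp [and_comm]
        simp only [sum_min_rootedClass_compl, hdiff, Option.elim_none, Option.elim_some] at hle
        have hE : ∀ p : E → Prop, [DecidablePred p] → (Finset.univ.filter p).card ≤ Fintype.card E :=
          fun p _ ↦ Finset.card_le_univ _
        have hE₁ := hE fun e ↦ Sum.inl e ∉ P.biUnion Prod.snd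
        have hE₂ := hE fun e ↦ Sum.inl e ∉ Z
        zify at hpart hcert
        omega
      · have h₁ := sum_le_sum_min_add_sum_min hs hsum (Finset.univ.filter fun p ↦ Sum.inr p ∈ Z)
        simp only [Finset.mem_filter, Finset.mem_univ, true_and] at h₁
        have h₂ := sum_min_le_indepRank (a := a) (b := b) (h := h) Z
        rw [min_eq_left (by exact_mod_cast (not_le.1 hZ).le), Nat.cast_sub hsum]
        zify at h₁ h₂
        push_cast
        linarith)
  have hI : CountIndep (rootedSupp a b) rootedCol h I := by
    obtain ⟨J, hJI, hJ, hJc⟩ := exists_indepRank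
      (Indep := CountIndep (rootedSupp a b) rootedCol h) CountIndep.empty I
    have : J = I := Finset.eq_of_subset_of_card_le hJI (by zify; rw [hJc, hI₁, hIc])
    exact this ▸ hJ
  refine ⟨I, hI, hIc, ?_⟩
  have hcards : ∑ c, (I.filter (rootedClass · = c)).card = h * Fintype.card V := by
    rw [← hIc]
    exact (Finset.card_eq_sum_card_fiberwise fun x _ ↦ Finset.mem_univ _).symm
  have hle : ∀ c, (I.filter (rootedClass · = c)).card ≤ cap c := by
    have heq : ∑ c, min (cap c) (I.filter (rootedClass · = c)).card =
        ∑ c, (I.filter (rootedClass · = c)).card := by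
      rw [hcards]; zify; exact hI₂
    have := (Finset.sum_eq_sum_iff_of_le fun c _ ↦ min_le_right (cap c) _).1 heq
    intro c
    have := this c (Finset.mem_univ _)
    omega
  have hcap : ∑ c, cap c = h * Fintype.card V := by
    rw [Fintype.sum_option]
    simp only [cap, Option.elim_none, Option.elim_some]
    omega
  have heq := (Finset.sum_eq_sum_iff_of_le fun c _ ↦ hle c).1 (hcards.trans hcap.symm)
  intro i
  rw [← card_rootedClass_some]
  exact heq (some i) (Finset.mem_univ _)

end rooted

/-! ### Packing in a suitable orientation -/

/-- Regular packings of branchings with prescribed numbers of roots, in some orientation. -/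
theorem exists_oriented_packing {V E κ : Type*} [DecidableEq V] [DecidableEq E] [DecidableEq κ]
    [Fintype V] [Fintype E] [Fintype κ] [Nonempty V] {a b : E → V} {h : ℕ} {s : κ → ℕ}
    (hs : ∀ i, s i ≤ Fintype.card V) (hsum : ∑ i, s i ≤ h * Fintype.card V)
    (hP : ∀ φ : V → Finset V, h * (Finset.univ.image φ).card ≤
      ∑ i, min (s i) (Finset.univ.image φ).card +
        (Finset.univ.filter fun e ↦ φ (a e) ≠ φ (b e)).card) :
    ∃ (tail head : E → V) (S W : κ → Finset V) (F : κ → Finset E),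
      (∀ e, tail e = a e ∧ head e = b e ∨ tail e = b e ∧ head e = a e) ∧
      (∀ i, (S i).card = s i) ∧ (∀ i, IsGrown tail head (S i) (W i) (F i)) ∧
      (∀ i j, i ≠ j → Disjoint (F i) (F j)) ∧
      ∀ v, (Finset.univ.filter (v ∈ W ·)).card = h := by
  obtain ⟨I, hI, hIc, hIs⟩ := exists_countIndep_card_eq hs hsum hP
  obtain ⟨hd, hdsupp, hdX⟩ := hI.exists_heads (rootedSupp_nonempty a b) hIc
  let head : E → V := fun e ↦ hd (Sum.inl e)
  let tail : E → V := fun e ↦ if head e = b e then a e else b e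
  have hor : ∀ e, tail e = a e ∧ head e = b e ∨ tail e = b e ∧ head e = a e := by
    intro e
    by_cases he : head e = b e
    · simp [tail, he]
    · have := hdsupp (Sum.inl e)
      simp only [rootedSupp, Sum.elim_inl, Finset.mem_insert, Finset.mem_singleton] at this
      exact Or.inr ⟨by simp [tail, he], this.resolve_right he⟩
  let S : κ → Finset V := fun i ↦ Finset.univ.filter fun v ↦ Sum.inr (v, i) ∈ I
  have hS : ∀ v, (Finset.univ.filter (v ∈ S ·)) = Finset.univ.filter fun i ↦ Sum.inr (v, i) ∈ I := by
    intro v; ext i; simp [S]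
  obtain ⟨W, F, hW, -, hF, hreg⟩ := exists_isGrown_packing (tail := tail) (head := head)
    (A := Finset.univ.filter fun e ↦ Sum.inl e ∈ I) (h := h) S S (fun _ ↦ ∅)
    (fun i ↦ IsGrown.base) (by simp) (by simp)
    (fun v ↦ by
      have := hI {v} (by simp) ((Finset.univ.filter fun i ↦ Sum.inr (v, i) ∈ I).map
        ((Function.Embedding.sectR v κ).trans Function.Embedding.inr))
        (fun x hx ↦ by
          obtain ⟨i, hi, rfl⟩ := Finset.mem_map.1 hx
          simpa using hi)
        (fun x hx ↦ by
          obtain ⟨i, hi, rfl⟩ := Finset.mem_map.1 hx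
          simp [rootedSupp])
      rw [Finset.card_map, Finset.card_singleton] at this
      rw [hS]
      omega)
    -- Cut condition: an element with its head in `X` is either supported in `X`, where independence
    -- limits the number, or an arc entering `X`.
    (fun X hX ↦ by
      have h₁ := hI X hX (I.filter (rootedSupp a b · ⊆ X)) (Finset.filter_subset _ _)
        fun x hx ↦ (Finset.mem_filter.1 hx).2
      have h₂ : (I.filter (hd · ∈ X)) ⊆ I.filter (rootedSupp a b · ⊆ X) ∪
          (entering tail head (Finset.univ.filter fun e ↦ Sum.inl e ∈ I) X).map
            Function.Embedding.inl := by
        intro x hx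
        obtain ⟨hxI, hxX⟩ := Finset.mem_filter.1 hx
        obtain e | p := x
        · by_cases ht : tail e ∈ X
          · refine Finset.mem_union_left _ (Finset.mem_filter.2 ⟨hxI, ?_⟩)
            change head e ∈ X at hxX
            obtain ⟨h₁, h₂⟩ | ⟨h₁, h₂⟩ := hor e <;>
              simp [rootedSupp, Finset.insert_subset_iff, ← h₁, ← h₂, ht, hxX]
          · refine Finset.mem_union_right _ (Finset.mem_map.2 ⟨e, ?_, rfl⟩)
            simpa [entering, hxI, ht] using hxX
        · refine Finset.mem_union_left _ (Finset.mem_filter.2 ⟨hxI, ?_⟩)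
          have := hdsupp (Sum.inr p)
          simp only [rootedSupp, Sum.elim_inr, Finset.mem_singleton,
            Finset.singleton_subset_iff] at this ⊢
          exact this ▸ hxX
      have h₃ := (hdX X).trans ((Finset.card_le_card h₂).trans (Finset.card_union_le _ _))
      rw [Finset.card_map] at h₃
      have h₄ : (I.filter (rootedSupp a b · ⊆ X)).biUnion rootedCol ⊆
          X.biUnion fun v ↦ Finset.univ.filter (v ∈ S ·) := by
        intro i hi
        obtain ⟨v, hv⟩ := mem_biUnion_rootedCol.1 hi
        obtain ⟨hvI, hvX⟩ := Finset.mem_filter.1 hv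
        refine Finset.mem_biUnion.2 ⟨v, by simpa [rootedSupp] using hvX, by simpa [S] using hvI⟩
      have h₅ := Finset.card_le_card h₄
      omega)
  exact ⟨tail, head, S, W, F, hor, hIs, hW, hF, hreg⟩

/-! ### Choosing the numbers of roots -/

lemma exists_le_sum_eq_aux {ι : Type*} [Fintype ι] (l : ι → ℕ) (t n : ℕ) (R : Set (ℕ × ℕ))
    (hlt : ∑ i, l i ≤ t) (hR : ∀ p ∈ R, p.2 + ∑ i, l i ≤ t + ∑ i, min (l i) p.1)
    (s : ι → ℕ) (hls : ∀ i, l i ≤ s i) (hs : ∑ i, s i = t + n)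
    (hRs : ∀ p ∈ R, p.2 ≤ ∑ i, min (s i) p.1) :
    ∃ s' : ι → ℕ, (∀ i, l i ≤ s' i) ∧ (∀ i, s' i ≤ s i) ∧ ∑ i, s' i = t ∧
      ∀ p ∈ R, p.2 ≤ ∑ i, min (s' i) p.1 := by
  classical
  induction n generalizing s with
  | zero => exact ⟨s, hls, fun _ ↦ le_rfl, hs, hRs⟩
  | succ n ih =>
    obtain ⟨i₀, hi₀⟩ : ∃ i, l i < s i := by
      by_contra! hno
      have := Finset.sum_le_sum fun i (_ : i ∈ Finset.univ) ↦ hno i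
      omega
    -- A largest entry exceeding its lower bound is decreased by one. Truncation above that entry
    -- then acts only on entries equal to their lower bounds, so the truncated sum follows from
    -- `hR`; truncation below it does not see the change.
    obtain ⟨i, hi, hmax⟩ := Finset.exists_max_image (Finset.univ.filter fun i ↦ l i < s i) s
      ⟨i₀, by simpa using hi₀⟩
    simp only [Finset.mem_filter, Finset.mem_univ, true_and] at hi hmax
    have hval : ∀ j, Function.update s i (s i - 1) j = if j = i then s i - 1 else s j :=
      fun j ↦ Function.update_apply ..
    have hsum : ∑ j, Function.update s i (s i - 1) j = t + n := by
      have h₁ := Finset.sum_update_of_mem (Finset.mem_univ i) s (s i - 1)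
      have h₂ := Finset.sum_sdiff (Finset.subset_univ {i}) (f := s)
      rw [Finset.sum_singleton] at h₂
      omega
    obtain ⟨s', h₁, h₂, h₃⟩ := ih (Function.update s i (s i - 1))
      (fun j ↦ by rw [hval]; split_ifs with hj <;> [(subst hj; omega); exact hls j]) hsum
      (fun p hp ↦ by
        obtain hlt | hge := lt_or_ge p.1 (s i)
        · refine (hRs p hp).trans (Finset.sum_le_sum fun j _ ↦ ?_)
          rw [hval]
          split_ifs with hj
          · subst hj; omega
          · rfl
        · have key : ∑ j, Function.update s i (s i - 1) j + ∑ j, min (l j) p.1 ≤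
              ∑ j, min (Function.update s i (s i - 1) j) p.1 + ∑ j, l j := by
            rw [← Finset.sum_add_distrib, ← Finset.sum_add_distrib]
            refine Finset.sum_le_sum fun j _ ↦ ?_
            have h₁ := hmax j
            have h₂ := hls j
            rw [hval]
            split_ifs with hj
            · omega
            · by_cases hj' : l j < s j
              · have := h₁ hj'
                omega
              · omega
          have := hR p hp
          omega)
    refine ⟨s', h₁, fun j ↦ (h₂ j).trans ?_, h₃⟩
    rw [hval]
    split_ifs with hj
    · subst hj; omega
    · rfl

/-- Integers between `l` and `l'` with prescribed sum, subject to lower bounds on truncated sums. -/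
lemma exists_between_sum_eq {ι : Type*} [Fintype ι] (l l' : ι → ℕ) (t : ℕ) (R : Set (ℕ × ℕ))
    (hll' : ∀ i, l i ≤ l' i) (hlt : ∑ i, l i ≤ t) (htl' : t ≤ ∑ i, l' i)
    (hR : ∀ p ∈ R, p.2 + ∑ i, l i ≤ t + ∑ i, min (l i) p.1)
    (hR' : ∀ p ∈ R, p.2 ≤ ∑ i, min (l' i) p.1) :
    ∃ s : ι → ℕ, (∀ i, l i ≤ s i) ∧ (∀ i, s i ≤ l' i) ∧ ∑ i, s i = t ∧
      ∀ p ∈ R, p.2 ≤ ∑ i, min (s i) p.1 :=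
  exists_le_sum_eq_aux l t (∑ i, l' i - t) R hlt hR l' hll' (by omega) hR'

/-- This is the lower-bound inequality for total `h * n`, needed when `h * |V|` is the smaller upper
bound. It holds because `min (l i) q` lies above its chord `l i * q / n` on `[0, n]`. -/
lemma mul_add_sum_le_mul_add_sum_min {ι : Type*} [Fintype ι] {l : ι → ℕ} {h n q : ℕ}
    (hl : ∀ i, l i ≤ n) (hsum : ∑ i, l i ≤ h * n) (hq : q ≤ n) :
    h * q + ∑ i, l i ≤ h * n + ∑ i, min (l i) q := by
  obtain rfl | hn := Nat.eq_zero_or_pos n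
  · obtain rfl : q = 0 := by omega
    simpa using hsum
  refine Nat.le_of_mul_le_mul_left ?_ hn
  have h₁ : ∀ i, n * l i ≤ l i * (n - q) + n * min (l i) q := by
    intro i
    have hi := hl i
    obtain hle | hgt := le_or_gt (l i) q
    · rw [min_eq_left hle]; exact Nat.le_add_left _ _
    · rw [min_eq_right hgt.le]
      zify [hq] at hi ⊢
      have : (0 : ℤ) ≤ q * (n - l i) := mul_nonneg (Nat.cast_nonneg _) (by linarith)
      linarith [mul_comm (n : ℤ) (l i), mul_comm (q : ℤ) (l i), mul_comm (q : ℤ) n]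
  have h₂ := Finset.sum_le_sum fun i (_ : i ∈ Finset.univ) ↦ h₁ i
  rw [Finset.sum_add_distrib, ← Finset.mul_sum, ← Finset.mul_sum, ← Finset.sum_mul] at h₂
  have h₃ := Nat.mul_le_mul_right (n - q) hsum
  have h₄ : h * n * (n - q) + n * (h * q) = n * (h * n) := by
    zify [hq]; ring
  rw [mul_add, mul_add]
  omega

/-! ### From grown sets to rooted forests in `Graph` -/

namespace IsGrown

variable {V E : Type*} [DecidableEq V] [DecidableEq E] {tail head : E → V} {S W : Finset V}
  {F : Finset E}

lemma subset (hW : IsGrown tail head S W F) : S ⊆ W := by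
  induction hW with
  | base => rfl
  | step e _ _ _ _ ih => exact ih.trans (Finset.subset_insert _ _)

lemma ends_mem (hW : IsGrown tail head S W F) : ∀ e ∈ F, tail e ∈ W ∧ head e ∈ W := by
  induction hW with
  | base => simp
  | step e _ ht _ _ ih =>
    intro f hf
    obtain rfl | hf := Finset.mem_insert.1 hf
    · exact ⟨Finset.mem_insert_of_mem ht, Finset.mem_insert_self _ _⟩
    · exact ⟨Finset.mem_insert_of_mem (ih f hf).1, Finset.mem_insert_of_mem (ih f hf).2⟩

lemma map {α β : Type*} [DecidableEq α] [DecidableEq β] {tail' head' : β → α} (f : V ↪ α)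
    (g : E ↪ β) (ht : ∀ e, tail' (g e) = f (tail e)) (hh : ∀ e, head' (g e) = f (head e))
    (hW : IsGrown tail head S W F) :
    IsGrown tail' head' (S.map f) (W.map f) (F.map g) := by
  induction hW with
  | base => exact IsGrown.base
  | step e _ h₁ h₂ h₃ ih =>
    rw [Finset.map_insert, Finset.map_insert, ← hh]
    refine ih.step (g e) ?_ ?_ ?_
    · rw [ht]; exact Finset.mem_map_of_mem f h₁
    · rw [hh]; simpa using h₂
    · simpa using h₃

end IsGrown

namespace Graph

variable {α β : Type*}

/-- The subgraph of `G` with vertex set `W` and the edges in `F` with both ends in `W`. -/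
def withFinsets (G : Graph α β) (W : Finset α) (F : Finset β) : Graph α β where
  vertexSet := W
  IsLink e x y := e ∈ F ∧ G.IsLink e x y ∧ x ∈ W ∧ y ∈ W
  isLink_symm _ _ := ⟨fun _ _ h ↦ ⟨h.1, h.2.1.symm, h.2.2.2, h.2.2.1⟩⟩
  eq_or_eq_of_isLink_of_isLink _ _ _ _ _ h h' := h.2.1.left_eq_or_eq h'.2.1
  left_mem_of_isLink _ _ _ h := h.2.2.1

lemma withFinsets_edgeSet {G : Graph α β} {W : Finset α} {F : Finset β} {tail head : β → α}
    (hlink : ∀ e ∈ F, G.IsLink e (tail e) (head e)) (hends : ∀ e ∈ F, tail e ∈ W ∧ head e ∈ W) :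
    E(G.withFinsets W F) = F := by
  ext e
  refine ⟨fun he ↦ ?_, fun he ↦ ?_⟩
  · obtain ⟨x, y, h⟩ := he
    exact h.1
  · exact ⟨_, _, he, hlink e he, hends e he⟩

lemma withFinsets_isOrientation {G : Graph α β} {W : Finset α} {F : Finset β} {tail head : β → α}
    (hlink : ∀ e ∈ F, G.IsLink e (tail e) (head e)) (hends : ∀ e ∈ F, tail e ∈ W ∧ head e ∈ W) :
    (G.withFinsets W F).IsOrientation tail head := fun e he ↦ by
  rw [withFinsets_edgeSet hlink hends] at he
  exact ⟨he, hlink e he, hends e he⟩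

variable {H H' : Graph α β} {tail head : β → α}

lemma IsDiWalk.mono (hV : V(H) ⊆ V(H')) (hE : E(H) ⊆ E(H')) {u v : α} {w : List β}
    (hw : H.IsDiWalk tail head u w v) : H'.IsDiWalk tail head u w v := by
  induction hw with
  | nil hu => exact .nil (hV hu)
  | cons he _ ih => exact .cons (hE he) ih

lemma IsDiWalk.append_edge {u : α} {w : List β} {e : β} (he : e ∈ E(H)) (hh : head e ∈ V(H))
    {v : α} (hw : H.IsDiWalk tail head u w v) (hv : v = tail e) :
    H.IsDiWalk tail head u (w ++ [e]) (head e) := by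
  induction hw with
  | nil hu => subst hv; exact .cons he (.nil hh)
  | cons he' _ ih => exact .cons he' (ih hv)

lemma IsDiWalk.exists_entering {u v : α} {w : List β} (hw : H.IsDiWalk tail head u w v)
    {X : Set α} (hu : u ∉ X) (hv : v ∈ X) : ∃ e ∈ E(H), tail e ∉ X ∧ head e ∈ X := by
  induction hw with
  | nil => exact absurd hv hu
  | @cons e _ _ he _ ih =>
    by_cases hX : head e ∈ X
    · exact ⟨e, he, hu, hX⟩
    · exact ih hX hv

lemma IsDiWalk.eq_nil {u v : α} {w : List β} (hw : H.IsDiWalk tail head u w v)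
    (hu : ∀ e ∈ E(H), tail e ≠ u) : w = [] ∧ v = u := by
  induction hw with
  | nil => exact ⟨rfl, rfl⟩
  | @cons e _ _ he _ _ => exact absurd rfl (hu e he)

variable [DecidableEq β]

/-- The new vertex `head e` has no outgoing edge, so a walk from `W` can use `e` only as its last
step. -/
lemma IsDiWalk.of_insert {W : Finset α} {F : Finset β} {e : β}
    (hV : V(H) = W) (hE : E(H) = F) (hE' : E(H') = (insert e F : Finset β))
    (hends : ∀ f ∈ F, tail f ∈ W ∧ head f ∈ W) (ht : tail e ∈ W) (hh : head e ∉ W)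
    {u v : α} {w : List β} (hw : H'.IsDiWalk tail head u w v) (hu : u ∈ W) :
    (v ∈ W ∧ H.IsDiWalk tail head u w v) ∨
      (v = head e ∧ ∃ w', w = w' ++ [e] ∧ H.IsDiWalk tail head u w' (tail e)) := by
  induction hw with
  | nil => exact Or.inl ⟨hu, .nil (hV ▸ hu)⟩
  | @cons f w v hf hw ih =>
    rw [hE', Finset.coe_insert] at hf
    by_cases hfe : f = e
    · subst hfe
      obtain ⟨rfl, rfl⟩ := hw.eq_nil fun g hg hgt ↦ by
        rw [hE', Finset.coe_insert] at hg
        obtain rfl | hg := hg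
        · exact hh (hgt ▸ hu)
        · exact hh (hgt ▸ (hends g hg).1)
      exact Or.inr ⟨rfl, [], rfl, .nil (hV ▸ hu)⟩
    · have hf : f ∈ F := hf.resolve_left hfe
      have hfE : f ∈ E(H) := hE ▸ hf
      obtain ⟨hv, hw'⟩ | ⟨hv, w', rfl, hw'⟩ := ih (hends f hf).2
      · exact Or.inl ⟨hv, .cons hfE hw'⟩
      · exact Or.inr ⟨hv, f :: w', rfl, .cons hfE hw'⟩

variable [DecidableEq α]

lemma isBranching_of_isGrown {S W : Finset α} {F : Finset β} (hW : IsGrown tail head S W F)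
    (hV : V(H) = W) (hE : E(H) = F) (hor : H.IsOrientation tail head) :
    H.IsBranching tail head S := by
  induction hW generalizing H with
  | base =>
    refine ⟨hV.symm.subset, fun u hu ↦ ⟨(u, []), ⟨?_, .nil hu⟩, ?_⟩⟩
    · rw [hV] at hu; exact hu
    · rintro ⟨v, w⟩ ⟨-, hw⟩
      obtain ⟨h₁, h₂⟩ := hw.eq_nil (by simp [hE])
      simp only at h₁ h₂
      rw [h₁, h₂]
  | @step W F e hW ht hh he ih =>
    have hlink : ∀ f ∈ F, H.IsLink f (tail f) (head f) := fun f hf ↦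
      hor f (hE ▸ Finset.mem_insert_of_mem hf)
    have hE₀ := withFinsets_edgeSet hlink hW.ends_mem
    have hV₀ : V(H.withFinsets W F) = W := rfl
    have hVH : V(H.withFinsets W F) ⊆ V(H) := by
      rw [hV, hV₀]; exact Finset.coe_subset.2 (Finset.subset_insert _ _)
    have hEH : E(H.withFinsets W F) ⊆ E(H) := by
      rw [hE, hE₀]; exact Finset.coe_subset.2 (Finset.subset_insert _ _)
    have hH := ih hV₀ hE₀ (withFinsets_isOrientation hlink hW.ends_mem)
    have hdec := fun {u v w} (hw : H.IsDiWalk tail head u w v) (hu : u ∈ W) ↦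
      hw.of_insert (H := H.withFinsets W F) hV₀ hE₀ hE hW.ends_mem ht hh hu
    have hheV : head e ∈ V(H) := hV ▸ Finset.mem_insert_self _ _
    have heE : e ∈ E(H) := hE ▸ Finset.mem_insert_self _ _
    refine ⟨hH.1.trans hVH, fun u hu ↦ ?_⟩
    rw [hV, Finset.coe_insert] at hu
    obtain rfl | hu := hu
    · obtain ⟨⟨x, w⟩, ⟨hxS, hxw⟩, huniq⟩ := hH.2 (tail e) ht
      refine ⟨(x, w ++ [e]), ⟨hxS, (hxw.mono hVH hEH).append_edge heE hheV rfl⟩, ?_⟩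
      rintro ⟨y, w'⟩ ⟨hyS, hyw⟩
      obtain ⟨h₁, -⟩ | ⟨-, w'', rfl, hw''⟩ := hdec hyw (hW.subset hyS)
      · exact absurd h₁ hh
      · have := huniq (y, w'') ⟨hyS, hw''⟩
        simp_all
    · obtain ⟨⟨x, w⟩, ⟨hxS, hxw⟩, huniq⟩ := hH.2 u hu
      refine ⟨(x, w), ⟨hxS, hxw.mono hVH hEH⟩, ?_⟩
      rintro ⟨y, w'⟩ ⟨hyS, hyw⟩
      obtain ⟨-, hyw'⟩ | ⟨rfl, -⟩ := hdec hyw (hW.subset hyS)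
      · exact huniq (y, w') ⟨hyS, hyw'⟩
      · exact absurd hu hh

end Graph

/-! ### Partitions as fibres, and transfer to `Graph` -/

namespace Graph

variable {α β : Type*} {G : Graph α β}

/-- The partition of `V(G)` into the fibres of a map. -/
def fibrePartition {γ : Type*} (G : Graph α β) (φ : V(G) → γ) : Partition V(G) where
  parts := Set.range fun v ↦ Subtype.val '' (φ ⁻¹' {φ v})
  sSupIndep' := by
    rw [sSupIndep_iff_pairwiseDisjoint]
    rintro _ ⟨v, rfl⟩ _ ⟨w, rfl⟩ hne
    refine Set.disjoint_left.2 ?_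
    rintro _ ⟨x, hx, rfl⟩ ⟨y, hy, hxy⟩
    obtain rfl := Subtype.val_injective hxy
    refine hne ?_
    simp only [Set.mem_preimage, Set.mem_singleton_iff] at hx hy
    simp only [← hx, ← hy]
  bot_notMem' := by
    rintro ⟨v, hv⟩
    exact Set.notMem_empty (v : α) (hv.subset ⟨v, rfl, rfl⟩)
  sSup_eq' := by
    ext x
    simp only [Set.sSup_eq_sUnion, Set.mem_sUnion, Set.mem_range, exists_exists_eq_and]
    constructor
    · rintro ⟨v, y, -, rfl⟩; exact y.2
    · intro hx; exact ⟨⟨x, hx⟩, ⟨x, hx⟩, rfl, rfl⟩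

lemma ncard_fibrePartition {γ : Type*} [DecidableEq γ] [Fintype V(G)] (φ : V(G) → γ) :
    (G.fibrePartition φ).parts.ncard = (Finset.univ.image φ).card := by
  have h₁ : (G.fibrePartition φ).parts =
      (fun c ↦ Subtype.val '' (φ ⁻¹' {c})) '' (Finset.univ.image φ : Finset γ) := by
    change Set.range _ = _
    rw [Finset.coe_image, Finset.coe_univ, Set.image_univ, ← Set.range_comp]
    rfl
  rw [h₁, Set.InjOn.ncard_image, Set.ncard_coe_finset]
  intro c hc d hd hcd
  simp only [Finset.coe_image, Finset.coe_univ, Set.image_univ, Set.mem_range] at hc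
  obtain ⟨v, rfl⟩ := hc
  have hv : (v : α) ∈ Subtype.val '' (φ ⁻¹' {d}) := hcd.subset ⟨v, rfl, rfl⟩
  obtain ⟨w, hw, hwv⟩ := hv
  obtain rfl := Subtype.val_injective hwv
  exact hw

lemma numCrossing_fibrePartition_le {γ : Type*} [DecidableEq γ] [Fintype E(G)] {φ : V(G) → γ}
    {a b : E(G) → V(G)} (hab : ∀ e : E(G), G.IsLink e (a e) (b e)) :
    G.numCrossing (G.fibrePartition φ) ≤
      (Finset.univ.filter fun e ↦ φ (a e) ≠ φ (b e)).card := by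
  rw [← Finset.card_map (Function.Embedding.subtype _), ← Set.ncard_coe_finset]
  refine Set.ncard_le_ncard ?_ (Finset.finite_toSet _)
  rintro e ⟨_, ⟨v, rfl⟩, x, y, hxy, ⟨x', hx', rfl⟩, hy⟩
  have he := hxy.edge_mem
  simp only [Finset.coe_map, Finset.coe_filter, Finset.mem_univ, true_and]
  refine ⟨⟨e, he⟩, ?_, rfl⟩
  intro heq
  refine hy ⟨⟨y, hxy.right_mem⟩, ?_, rfl⟩
  obtain ⟨h₁, h₂⟩ | ⟨h₁, h₂⟩ := (hab ⟨e, he⟩).eq_and_eq_or_eq_and_eq hxy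
  · have h₁ : a ⟨e, he⟩ = x' := Subtype.ext h₁
    have h₂ : b ⟨e, he⟩ = ⟨y, hxy.right_mem⟩ := Subtype.ext h₂
    rw [← h₁] at hx'
    rw [← h₂]
    exact heq.symm.trans hx'
  · have h₁ : a ⟨e, he⟩ = ⟨y, hxy.right_mem⟩ := Subtype.ext h₁
    have h₂ : b ⟨e, he⟩ = x' := Subtype.ext h₂
    rw [← h₂] at hx'
    rw [← h₁]
    exact heq.trans hx'

/-- Existence of regular packings with prescribed numbers of roots. -/
theorem exists_isRegularForestPacking (hV : V(G).Finite) (hE : E(G).Finite) (hne : V(G).Nonempty)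
    {h k : ℕ} {s : Fin k → ℕ} (hs : ∀ i, s i ≤ V(G).ncard) (hsum : ∑ i, s i ≤ h * V(G).ncard)
    (hP : ∀ P : Partition V(G),
      h * P.parts.ncard ≤ ∑ i, min (s i) P.parts.ncard + G.numCrossing P) :
    ∃ (B : Fin k → Graph α β) (S : Fin k → Finset α),
      G.IsRegularForestPacking h B S ∧ ∀ i, (S i).card = s i := by
  classical
  have := hV.fintype
  have := hE.fintype
  have := hne.to_subtype
  have hends : ∀ e : E(G), ∃ p : V(G) × V(G), G.IsLink e p.1 p.2 := fun e ↦ by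
    obtain ⟨x, y, hxy⟩ := exists_isLink_of_mem_edgeSet e.2
    exact ⟨(⟨x, hxy.left_mem⟩, ⟨y, hxy.right_mem⟩), hxy⟩
  choose ab hab using hends
  have hcard : Fintype.card V(G) = V(G).ncard := by
    rw [Set.ncard_eq_toFinset_card' , Set.toFinset_card]
  rw [← hcard] at hsum
  simp only [← hcard] at hs
  obtain ⟨tail, head, S, W, F, hor, hS, hW, hF, hreg⟩ := exists_oriented_packing
    (a := fun e ↦ (ab e).1) (b := fun e ↦ (ab e).2) hs hsum (fun φ ↦ by
      have h₁ := hP (G.fibrePartition φ)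
      rw [ncard_fibrePartition] at h₁
      exact h₁.trans (Nat.add_le_add_left (numCrossing_fibrePartition_le hab) _))
  have hlink : ∀ e : E(G), G.IsLink e (tail e) (head e) := fun e ↦ by
    obtain ⟨h₁, h₂⟩ | ⟨h₁, h₂⟩ := hor e
    · rw [h₁, h₂]; exact hab e
    · rw [h₁, h₂]; exact (hab e).symm
  let f : V(G) ↪ α := Function.Embedding.subtype _
  let g : E(G) ↪ β := Function.Embedding.subtype _
  let tail' : β → α := fun e ↦ if he : e ∈ E(G) then tail ⟨e, he⟩ else hne.some
  let head' : β → α := fun e ↦ if he : e ∈ E(G) then head ⟨e, he⟩ else hne.some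
  have ht' : ∀ e, tail' (g e) = f (tail e) := fun e ↦ by simp [tail', f, g]
  have hh' : ∀ e, head' (g e) = f (head e) := fun e ↦ by simp [head', f, g]
  have hgrown := fun i ↦ (hW i).map f g ht' hh'
  have hlink' : ∀ i, ∀ e ∈ (F i).map g, G.IsLink e (tail' e) (head' e) := by
    intro i e he
    obtain ⟨e, -, rfl⟩ := Finset.mem_map.1 he
    rw [ht', hh']
    exact hlink e
  have hEi := fun i ↦ withFinsets_edgeSet (hlink' i) (hgrown i).ends_mem
  refine ⟨fun i ↦ G.withFinsets ((W i).map f) ((F i).map g), fun i ↦ (S i).map f, ⟨?_, ?_, ?_, ?_⟩,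
    fun i ↦ by rw [Finset.card_map, hS]⟩
  · refine fun i ↦ ⟨fun x hx ↦ ?_, fun e x y h ↦ h.2.1⟩
    obtain ⟨v, -, rfl⟩ := Finset.mem_map.1 hx
    exact v.2
  · exact fun i ↦ ⟨tail', head', withFinsets_isOrientation (hlink' i) (hgrown i).ends_mem,
      isBranching_of_isGrown (hgrown i) rfl (hEi i)
        (withFinsets_isOrientation (hlink' i) (hgrown i).ends_mem)⟩
  · intro i j hij
    rw [hEi, hEi, Finset.disjoint_coe, Finset.disjoint_map]
    exact hF i j hij
  · intro v hv
    rw [← hreg ⟨v, hv⟩, ← Set.ncard_coe_finset]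
    congr 1
    ext i
    simp [withFinsets, f, hv]

end Graph

/-! ### Necessity: counting in a given packing -/

namespace Graph

variable {α β : Type*} {G : Graph α β} {h k : ℕ} {B : Fin k → Graph α β} {S : Fin k → Finset α}

lemma IsRegularForestPacking.subset_vertexSet (hB : G.IsRegularForestPacking h B S) (i : Fin k) :
    (S i : Set α) ⊆ V(B i) := by
  obtain ⟨tail, head, -, hbr⟩ := hB.isRootedForest i
  exact hbr.1

lemma IsRegularForestPacking.sum_card_le (hB : G.IsRegularForestPacking h B S)
    (hV : V(G).Finite) : ∑ i, (S i).card ≤ h * V(G).ncard := by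
  classical
  have h₁ : ∀ i, S i ⊆ hV.toFinset.filter (· ∈ V(B i)) := fun i x hx ↦ by
    have hx' := hB.subset_vertexSet i hx
    exact Finset.mem_filter.2 ⟨hV.mem_toFinset.2 ((hB.le i).vertexSet_mono hx'), hx'⟩
  calc ∑ i, (S i).card ≤ ∑ i, (hV.toFinset.filter (· ∈ V(B i))).card :=
        Finset.sum_le_sum fun i _ ↦ Finset.card_le_card (h₁ i)
    _ = ∑ v ∈ hV.toFinset, (Finset.univ.filter fun i ↦ v ∈ V(B i)).card := by
        simp only [Finset.card_filter]
        exact Finset.sum_comm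
    _ = ∑ v ∈ hV.toFinset, h := Finset.sum_congr rfl fun v hv ↦ by
        rw [← hB.regular v (hV.mem_toFinset.1 hv), ← Set.ncard_coe_finset]
        congr 1
        ext i
        simp
    _ = h * V(G).ncard := by
        rw [Finset.sum_const, smul_eq_mul, mul_comm, Set.ncard_eq_toFinset_card _ hV]

/-- Pairs (member `X`, forest meeting `X`) are counted twice: at least `h` per member, and at most
roots plus crossing edges per forest. -/
lemma IsRegularForestPacking.mul_ncard_le (hB : G.IsRegularForestPacking h B S)
    (hV : V(G).Finite) (hE : E(G).Finite) (P : Partition V(G)) :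
    h * P.parts.ncard ≤ ∑ i, min (S i).card P.parts.ncard + G.numCrossing P := by
  classical
  have hPfin : P.parts.Finite := hV.finite_subsets.subset fun X hX ↦ P.subset_of_mem hX
  have hKfin : {e : β | ∃ X ∈ P.parts, ∃ x y, G.IsLink e x y ∧ x ∈ X ∧ y ∉ X}.Finite :=
    hE.subset fun e ⟨_, _, _, _, hl, _⟩ ↦ hl.edge_mem
  set Q := hPfin.toFinset with hQ
  set K := hKfin.toFinset with hK
  have hQc : P.parts.ncard = Q.card := Set.ncard_eq_toFinset_card _ hPfin
  have hKc : G.numCrossing P = K.card := Set.ncard_eq_toFinset_card _ hKfin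
  have hmemQ : ∀ X, X ∈ Q ↔ X ∈ P.parts := fun X ↦ hPfin.mem_toFinset
  have hreg : ∀ X ∈ Q, h ≤ (Finset.univ.filter fun i ↦ (V(B i) ∩ X).Nonempty).card := by
    intro X hX
    have hXP := (hmemQ X).1 hX
    obtain ⟨v, hv⟩ := P.nonempty_of_mem hXP
    rw [← hB.regular v (P.subset_of_mem hXP hv), ← Set.ncard_coe_finset]
    refine Set.ncard_le_ncard (fun i hi ↦ ?_) (Finset.finite_toSet _)
    simpa using ⟨v, hi, hv⟩
  have hcount : ∀ i, (Q.filter fun X ↦ (V(B i) ∩ X).Nonempty).card ≤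
      min (S i).card Q.card + (K.filter (· ∈ E(B i))).card := by
    intro i
    obtain ⟨tail, head, hor, hbr⟩ := hB.isRootedForest i
    have hroots : (Q.filter fun X ↦ ((S i : Set α) ∩ X).Nonempty).card ≤ min (S i).card Q.card := by
      refine le_min ?_ (Finset.card_filter_le _ _)
      refine Finset.card_le_card_of_forall_subsingleton (fun X x ↦ x ∈ X) (fun X hX ↦ ?_)
        fun x _ X hX Y hY ↦ ?_
      · obtain ⟨x, hxS, hxX⟩ := (Finset.mem_filter.1 hX).2
        exact ⟨x, hxS, hxX⟩
      · have hX' := (hmemQ X).1 (Finset.mem_filter.1 hX.1).1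
        have hY' := (hmemQ Y).1 (Finset.mem_filter.1 hY.1).1
        exact P.eq_of_mem_of_mem hX' hY' hX.2 hY.2
    -- A walk from a root to a vertex of a rootless member must enter it; the head of the entering
    -- arc determines the member.
    have harcs : ((Q.filter fun X ↦ (V(B i) ∩ X).Nonempty).filter
        fun X ↦ ¬ ((S i : Set α) ∩ X).Nonempty).card ≤ (K.filter (· ∈ E(B i))).card := by
      refine Finset.card_le_card_of_forall_subsingleton (fun X e ↦ head e ∈ X) (fun X hX ↦ ?_)
        fun e _ X hX Y hY ↦ ?_
      · simp only [Finset.mem_filter] at hX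
        obtain ⟨⟨hXQ, v, hvB, hvX⟩, hno⟩ := hX
        obtain ⟨⟨x, w⟩, ⟨hxS, hw⟩, -⟩ := hbr.2 v hvB
        obtain ⟨e, he, ht, hh⟩ := hw.exists_entering (fun hxX ↦ hno ⟨x, hxS, hxX⟩) hvX
        refine ⟨e, Finset.mem_filter.2 ⟨hKfin.mem_toFinset.2 ?_, he⟩, hh⟩
        exact ⟨X, (hmemQ X).1 hXQ, head e, tail e, ((hor e he).mono (hB.le i)).symm, hh, ht⟩
      · simp only [Finset.mem_filter] at hX hY
        exact P.eq_of_mem_of_mem ((hmemQ X).1 hX.1.1.1) ((hmemQ Y).1 hY.1.1.1) hX.2 hY.2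
    have hsplit := Finset.card_filter_add_card_filter_not
      (s := Q.filter fun X ↦ (V(B i) ∩ X).Nonempty) fun X ↦ ((S i : Set α) ∩ X).Nonempty
    have hle : ((Q.filter fun X ↦ (V(B i) ∩ X).Nonempty).filter
        fun X ↦ ((S i : Set α) ∩ X).Nonempty).card ≤
        (Q.filter fun X ↦ ((S i : Set α) ∩ X).Nonempty).card :=
      Finset.card_le_card (Finset.filter_subset_filter _ (Finset.filter_subset _ _))
    omega
  have hKle : ∑ i, (K.filter (· ∈ E(B i))).card ≤ K.card := by
    rw [← Finset.card_biUnion]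
    · exact Finset.card_le_card (Finset.biUnion_subset.2 fun i _ ↦ Finset.filter_subset _ _)
    · intro i _ j _ hij
      refine Finset.disjoint_left.2 fun e hi hj ↦ ?_
      exact Set.disjoint_left.1 (hB.edgeDisjoint i j hij) (Finset.mem_filter.1 hi).2
        (Finset.mem_filter.1 hj).2
  rw [hQc, hKc]
  calc h * Q.card = ∑ X ∈ Q, h := by rw [Finset.sum_const, smul_eq_mul, mul_comm]
    _ ≤ ∑ X ∈ Q, (Finset.univ.filter fun i ↦ (V(B i) ∩ X).Nonempty).card := Finset.sum_le_sum hreg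
    _ = ∑ i, (Q.filter fun X ↦ (V(B i) ∩ X).Nonempty).card := by
        simp only [Finset.card_filter]
        exact Finset.sum_comm
    _ ≤ ∑ i, (min (S i).card Q.card + (K.filter (· ∈ E(B i))).card) :=
        Finset.sum_le_sum fun i _ ↦ hcount i
    _ ≤ _ := by
        rw [Finset.sum_add_distrib]
        exact Nat.add_le_add_left hKle _

end Graph

/-! ### The equivalence -/

theorem mainTheorem2 {α β : Type*} (G : Graph α β) (hV : V(G).Finite) (hE : E(G).Finite)
    (h k : ℕ) (hh : 0 < h) (hk : 0 < k)
    (l l' : Fin (k + 1) → ℕ) (hl : ∀ i, 0 < l i) (hl' : ∀ i, 0 < l' i)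
    (h₁ : l' 0 ≤ ∑ i : Fin k, l' i.succ) (h₂ : l 0 ≤ l' 0) (h₃ : ∑ i : Fin k, l i.succ ≤ l 0)
    (h₄ : ∀ i : Fin k, l' i.succ ≤ V(G).ncard) (h₅ : ∀ i : Fin k, l i.succ ≤ l' i.succ) :
    (∃ (B : Fin k → Graph α β) (S : Fin k → Finset α),
        G.IsRegularForestPacking h B S ∧
        (∀ i : Fin k, l i.succ ≤ (S i).card ∧ (S i).card ≤ l' i.succ) ∧
        l 0 ≤ ∑ i : Fin k, (S i).card ∧ ∑ i : Fin k, (S i).card ≤ l' 0) ↔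
      (l 0 ≤ h * V(G).ncard ∧
        (∀ P : Partition V(G),
          (h : ℤ) * P.parts.ncard ≤
            (l' 0 : ℤ) - (∑ i : Fin k, (l i.succ : ℤ))
              + (∑ i : Fin k, min (l i.succ : ℤ) P.parts.ncard) + G.numCrossing P) ∧
        (∀ P : Partition V(G),
          h * P.parts.ncard ≤
            (∑ i : Fin k, min (l' i.succ) P.parts.ncard) + G.numCrossing P)) := by
  constructor
  · rintro ⟨B, S, hB, hS, hlow, hup⟩
    refine ⟨hlow.trans (hB.sum_card_le hV), fun P ↦ ?_, fun P ↦ ?_⟩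
    · have key := hB.mul_ncard_le hV hE P
      -- Truncation is 1-Lipschitz: raising ℓ(i) to |S_i| raises the truncated value by at most
      -- |S_i| - ℓ(i).
      have hmin : ∑ i, min (S i).card P.parts.ncard + ∑ i : Fin k, l i.succ ≤
          ∑ i, (S i).card + ∑ i : Fin k, min (l i.succ) P.parts.ncard := by
        rw [← Finset.sum_add_distrib, ← Finset.sum_add_distrib]
        refine Finset.sum_le_sum fun i _ ↦ ?_
        have := (hS i).1
        omega
      zify at key hmin hup
      linarith
    · refine (hB.mul_ncard_le hV hE P).trans (Nat.add_le_add_right (Finset.sum_le_sum fun i _ ↦ ?_) _)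
      have := (hS i).2
      omega
  · rintro ⟨hn, hlow, hup⟩
    have hne : V(G).Nonempty := by
      rw [← Set.ncard_pos hV]
      exact (hl' _).trans_le (h₄ ⟨0, hk⟩)
    -- Natural subtraction is harmless here: a partition with more crossing edges than `h * |P|`
    -- imposes no constraint.
    let R : Set (ℕ × ℕ) := Set.range fun P : Partition V(G) ↦
      (P.parts.ncard, h * P.parts.ncard - G.numCrossing P)
    obtain ⟨s, hs₁, hs₂, hs₃, hs₄⟩ := exists_between_sum_eq (fun i : Fin k ↦ l i.succ)
      (fun i ↦ l' i.succ) (min (l' 0) (h * V(G).ncard)) R h₅ (by simp only [le_min_iff]; omega)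
      ((min_le_left _ _).trans h₁)
      (by
        rintro _ ⟨P, rfl⟩
        have hle : P.parts.ncard ≤ V(G).ncard := by
          have hsub : P.parts ⊆ P.partOf '' V(G) := fun X hX ↦ by
            obtain ⟨x, hx⟩ := P.nonempty_of_mem hX
            exact ⟨x, P.subset_of_mem hX hx, (P.eq_partOf_of_mem hX hx).symm⟩
          exact (Set.ncard_le_ncard hsub (hV.image _)).trans (Set.ncard_image_le hV)
        -- The prescribed total is a minimum: `k₁` handles ℓ'(0) and `k₂` handles `h * |V|`.
        have k₁ := hlow P
        have k₂ := mul_add_sum_le_mul_add_sum_min (h := h) (fun i ↦ (h₅ i).trans (h₄ i))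
          (h₃.trans hn) hle
        have e₁ : (∑ i : Fin k, (l i.succ : ℤ)) = ((∑ i : Fin k, l i.succ : ℕ) : ℤ) := by push_cast; rfl
        have e₂ : (∑ i : Fin k, min (l i.succ : ℤ) P.parts.ncard) =
          ((∑ i : Fin k, min (l i.succ) P.parts.ncard : ℕ) : ℤ) := by push_cast; rfl
        have e₃ : (h : ℤ) * P.parts.ncard = ((h * P.parts.ncard : ℕ) : ℤ) := by push_cast; rfl
        rw [e₁, e₂, e₃] at k₁
        have k₃ : ∑ i : Fin k, min (l i.succ) P.parts.ncard ≤ ∑ i : Fin k, l i.succ :=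
          Finset.sum_le_sum fun i _ ↦ min_le_left _ _
        simp only
        omega)
      (by
        rintro _ ⟨P, rfl⟩
        have := hup P
        simp only
        omega)
    obtain ⟨B, S, hB, hS⟩ := Graph.exists_isRegularForestPacking hV hE hne
      (fun i ↦ (hs₂ i).trans (h₄ i)) (hs₃.le.trans (min_le_right _ _)) (fun P ↦ by
        have := hs₄ _ ⟨P, rfl⟩
        simp only at this
        omega)
    refine ⟨B, S, hB, fun i ↦ ?_, ?_⟩
    · rw [hS]; exact ⟨hs₁ i, hs₂ i⟩
    · simp only [hS, hs₃]
      omega
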